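/- Let $\alpha>2$, $\theta>0$ and $h>0$. For every density $\lambda>0$ let the base stations (BSs) be located at the points $x_0,x_1,\dots$ of a homogeneous Poisson point process of density $\lambda$ in $\mathbb{R}^2$, and let their power fading gains $g_0,g_1,\dots$ be i.i.d. exponential random variables with mean $1$, independent of the locations. All BSs have height $h$, and the path loss at horizontal distance $r$ is $\ell(r,h)=(r^2+h^2)^{-\alpha/2}$. The typical user, at the origin, is served by its closest BS, with (almost surely unique) index $i_*$, and all other BSs interfere. Define the coverage probability and the area spectral efficiency (ASE) by $$\mathrm{P}_{\mathrm{cov}}^{(\mathrm{C})}(\theta,\lambda)=\Pr\bigg[\frac{g_{i_*}\,\ell(\|x_{i_*}\|,h)}{\sum_{j\neq i_*}g_j\,\ell(\|x_j\|,h)}>\theta\bigg],\qquad \mathrm{ASE}^{(\mathrm{C})}(\theta,\lambda)=\lambda\,\mathrm{P}_{\mathrm{cov}}^{(\mathrm{C})}(\theta,\lambda)\,\log_2(1+\theta).$$ Let $\eta=\eta(\theta,1,1)$, where $\eta(s,m,r)={}_2F_1\big(m,-\tfrac2\alpha;1-\tfrac2\alpha;-\tfrac{s}{m r^\alpha}\big)$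 and ${}_2F_1$ denotes the principal branch, on $\mathbb{C}\setminus[1,\infty)$, of the Gauss hypergeometric function. Then the function $\lambda\mapsto\mathrm{ASE}^{(\mathrm{C})}(\theta,\lambda)$ on $(0,\infty)$ attains its maximum at exactly one point, namely $$\lambda_{\mathrm{opt}}^{(\mathrm{C})}=\frac{1}{\pi h^2(\eta-1)},$$ and the maximum is $$\mathrm{ASE}^{(\mathrm{C})}\big(\theta,\lambda_{\mathrm{opt}}^{(\mathrm{C})}\big)=\frac{e^{-1}\log_2(1+\theta)}{\pi h^2\,\eta\,(\eta-1)}.$$ In particular, there is a constant $C>0$ depending only on $\alpha$ and $\theta$ such that the maximum equals $C/h^2$ for every $h>0$. -/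

import Mathlib

noncomputable section

/-- `F` is the principal branch of the Gauss hypergeometric function with parameters `a, b, c`:
it is holomorphic on the plane cut along `[1, ∞)` and is the sum of the hypergeometric series in
the open unit disc. -/
def IsGaussHypergeometric (a b c : ℂ) (F : ℂ → ℂ) : Prop :=
  DifferentiableOn ℂ F {z : ℂ | 1 - z ∈ Complex.slitPlane} ∧
    ∀ z : ℂ, ‖z‖ < 1 → F z = ordinaryHypergeometric a b c z

open Classical in
/-- The Gauss hypergeometric function on the plane cut along `[1, ∞)`. The function
`ordinaryHypergeometric` is the sum of the series only, and `0` where the series diverges, so that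
it cannot be used outside the unit disc. -/
def gaussHypergeometric (a b c : ℂ) (z : ℂ) : ℂ :=
  if hF : ∃ F : ℂ → ℂ, IsGaussHypergeometric a b c F then hF.choose z else 0

/-- On the cut plane the value does not depend on the choice made in the definition. -/
theorem IsGaussHypergeometric.gaussHypergeometric_eq {a b c : ℂ} {F : ℂ → ℂ}
    (hF : IsGaussHypergeometric a b c F) {z : ℂ} (hz : 1 - z ∈ Complex.slitPlane) :
    gaussHypergeometric a b c z = F z := by
  have hex : ∃ F : ℂ → ℂ, IsGaussHypergeometric a b c F := ⟨F, hF⟩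
  have hG := hex.choose_spec
  have hopen : IsOpen {z : ℂ | 1 - z ∈ Complex.slitPlane} :=
    Complex.isOpen_slitPlane.preimage (by fun_prop)
  have hstar : StarConvex ℝ (0 : ℂ) {z : ℂ | 1 - z ∈ Complex.slitPlane} := by
    rw [starConvex_zero_iff]
    intro w hw t ht0 ht1
    have h1 := Complex.starConvex_one_slitPlane hw (sub_nonneg.2 ht1) ht0 (by ring)
    have h2 : 1 - t • w = (1 - t) • (1 : ℂ) + t • (1 - w) := by
      simp only [Complex.real_smul]
      push_cast
      ring
    simpa only [Set.mem_ofPred_eq, h2] using h1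
  have h0 : (0 : ℂ) ∈ {z : ℂ | 1 - z ∈ Complex.slitPlane} := by simp
  have hpre : IsPreconnected {z : ℂ | 1 - z ∈ Complex.slitPlane} :=
    (hstar.isPathConnected h0).isConnected.isPreconnected
  have heq : Set.EqOn hex.choose F {z : ℂ | 1 - z ∈ Complex.slitPlane} := by
    refine (hG.1.analyticOnNhd hopen).eqOn_of_preconnected_of_eventuallyEq
      (hF.1.analyticOnNhd hopen) hpre h0 ?_
    filter_upwards [Metric.ball_mem_nhds (0 : ℂ) one_pos] with w hw
    have hw' : ‖w‖ < 1 := by simpa using hw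
    rw [hG.2 w hw', hF.2 w hw']
  unfold gaussHypergeometric
  rw [dif_pos hex]
  exact heq hz

/-- `η(s, m, r) = ₂F₁(m, -2/α; 1 - 2/α; -s / (m r ^ α))`, for the path loss exponent `α`. -/
def eta (α s : ℝ) (m : ℕ) (r : ℝ) : ℝ :=
  (gaussHypergeometric (m : ℂ) ((-(2 / α) : ℝ) : ℂ) ((1 - 2 / α : ℝ) : ℂ)
    ((-(s / (m * r ^ α)) : ℝ) : ℂ)).re

/-- The path loss at horizontal distance `r` from a base station of height `h`. -/
def pathloss (α h r : ℝ) : ℝ := (r ^ 2 + h ^ 2) ^ (-(α / 2))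

section Network

variable {Ω : Type*} [MeasurableSpace Ω]

/-- The random points `x 0, x 1, …` of the plane form a homogeneous Poisson point process of
density `lam`: the numbers of points in pairwise disjoint bounded Borel sets are independent, and
the number of points in `B` has the Poisson distribution with mean `lam * volume B`. -/
structure IsPoissonPointProcess (lam : ℝ) (x : ℕ → Ω → EuclideanSpace ℝ (Fin 2))
    (P : MeasureTheory.Measure Ω) : Prop where
  measurable : ∀ i, Measurable (x i)
  law : ∀ (n : ℕ) (B : Fin n → Set (EuclideanSpace ℝ (Fin 2))),
    (∀ j, MeasurableSet (B j)) → (∀ j, Bornology.IsBounded (B j)) →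
    Pairwise (Function.onFun Disjoint B) → ∀ k : Fin n → ℕ,
      P {ω | ∀ j, Set.encard {i : ℕ | x i ω ∈ B j} = k j} =
        ∏ j, ProbabilityTheory.poissonMeasure
          (Real.toNNReal (lam * (MeasureTheory.volume (B j)).toReal)) {k j}

/-- Base stations at the points `x i` of a homogeneous Poisson point process of density `lam`,
marked by power fading gains `g i` (Rayleigh fading) which are i.i.d. exponential with mean `1`
and independent of the locations. -/
structure IsRayleighNetwork (lam : ℝ) (x : ℕ → Ω → EuclideanSpace ℝ (Fin 2)) (g : ℕ → Ω → ℝ)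
    (P : MeasureTheory.Measure Ω) : Prop where
  poisson : IsPoissonPointProcess lam x P
  measurable_gain : ∀ i, Measurable (g i)
  gain_law : ∀ i, P.map (g i) = ProbabilityTheory.expMeasure 1
  gain_indep : ProbabilityTheory.iIndepFun g P
  indep : ProbabilityTheory.IndepFun (fun ω i => x i ω) (fun ω i => g i ω) P

/-- The signal-to-interference ratio at the origin (the typical user) when the serving base
station is the `i`-th one and all the others interfere; values in `[0, ∞]`. -/
def sir (α h : ℝ) (x : ℕ → Ω → EuclideanSpace ℝ (Fin 2)) (g : ℕ → Ω → ℝ) (i : ℕ) (ω : Ω) :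
    ENNReal :=
  ENNReal.ofReal (g i ω * pathloss α h ‖x i ω‖) /
    ∑' j : {j : ℕ // j ≠ i}, ENNReal.ofReal (g j ω * pathloss α h ‖x j ω‖)

/-- The coverage probability for closest association: the probability that the ratio at the
origin exceeds `θ` when the origin is served by the (almost surely unique) base station which is
closest to it. -/
def coverageProbClosest (α h θ : ℝ) (x : ℕ → Ω → EuclideanSpace ℝ (Fin 2)) (g : ℕ → Ω → ℝ)
    (P : MeasureTheory.Measure Ω) : ℝ :=
  P.real {ω | ∃ i, (∀ j, ‖x i ω‖ ≤ ‖x j ω‖) ∧ ENNReal.ofReal θ < sir α h x g i ω}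

/-- The achievable area spectral efficiency for closest association. -/
def aseClosest (α h θ lam : ℝ) (x : ℕ → Ω → EuclideanSpace ℝ (Fin 2)) (g : ℕ → Ω → ℝ)
    (P : MeasureTheory.Measure Ω) : ℝ :=
  lam * coverageProbClosest α h θ x g P * Real.logb 2 (1 + θ)

end Network

/-- The optimal density of base stations for closest association. -/
def lamOpt (α h θ : ℝ) : ℝ := 1 / (Real.pi * h ^ 2 * (eta α θ 1 1 - 1))

end

/-!
Only the closest base station matters for the signal, so the coverage probability is an integral
over its squared distance `u`. Given the locations, exponential fading turns the event that the
signal-to-interference ratio exceeds `θ` into a product: its probability is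
`exp (-∑ j, log (1 + θ / ρ j ^ (α / 2)))`, where `ρ j` is the ratio of `r ^ 2 + h ^ 2` for the
`j`-th interferer to that for the serving station. Given that the closest station is at squared
distance `u`, the others form a Poisson process outside that disc, and its Laplace functional
together with the substitution `ρ = (v + h ^ 2) / (u + h ^ 2)` yields
`exp (-λ π (u + h ^ 2) (η - 1))`, because `η - 1` is the integral over `ρ > 1` of
`θ ρ ^ (-α / 2) / (1 + θ ρ ^ (-α / 2))`. Multiplying by the density `λ π exp (-λ π u)` of `u` and
integrating gives `exp (-λ π h ^ 2 (η - 1)) / η`, and `λ exp (-a λ)` is maximal exactly at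
`λ = 1 / a`.

To avoid conditioning on a null event, the closest station is located only up to a ring: on the
event that the ring `k ε ≤ r ^ 2 < (k + 1) ε` contains one station and its inside none, the coverage
probability is known up to the values of the density at the two ends of the ring, and the remaining
event has probability at most `λ π ε`.
-/

noncomputable section

open MeasureTheory Set Filter Topology ProbabilityTheory
open scoped ENNReal NNReal

section Hypergeometric

theorem ascPochhammer_eval_mul_add {R : Type*} [CommRing R] (a : R) (n : ℕ) :
    (ascPochhammer R n).eval a * (a + n) = a * (ascPochhammer R n).eval (a + 1) := by
  rw [← ascPochhammer_succ_eval, ascPochhammer_succ_left, Polynomial.eval_mul, Polynomial.eval_X,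
    Polynomial.eval_comp, Polynomial.eval_add, Polynomial.eval_X, Polynomial.eval_one]

theorem ordinaryHypergeometric_one_eq_tsum {𝕜 : Type*} [RCLike 𝕜] {a : 𝕜}
    (ha : ∀ n : ℕ, a + n ≠ 0) (z : 𝕜) :
    ordinaryHypergeometric 1 a (a + 1) z = ∑' n : ℕ, a / (a + n) * z ^ n := by
  rw [ordinaryHypergeometric_eq_tsum]
  refine tsum_congr fun n => ?_
  have hpoch : (ascPochhammer 𝕜 n).eval (a + 1) ≠ 0 := by
    rw [ne_eq, ascPochhammer_eval_eq_zero_iff]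
    rintro ⟨k, -, hk⟩
    exact ha (k + 1) (by push_cast; linear_combination hk)
  have hfact : (n.factorial : 𝕜) ≠ 0 := by exact_mod_cast n.factorial_ne_zero
  have hshift := ascPochhammer_eval_mul_add a n
  have han := ha n
  rw [ascPochhammer_eval_one, smul_eq_mul]
  congr 1
  field_simp
  linear_combination hshift

theorem one_sub_mul_ofReal_mem_slitPlane {z : ℂ} (hz : 1 - z ∈ Complex.slitPlane) {t : ℝ}
    (ht : t ∈ Icc (0 : ℝ) 1) : 1 - z * t ∈ Complex.slitPlane := by
  have hcomb := Complex.starConvex_one_slitPlane hz (sub_nonneg.2 ht.2) ht.1 (by ring)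
  have : 1 - z * t = (1 - t) • (1 : ℂ) + t • (1 - z) := by
    simp only [Complex.real_smul]
    push_cast
    ring
  rwa [this]

theorem exists_le_norm_one_sub_mul_ofReal {z₀ : ℂ} (hz₀ : 1 - z₀ ∈ Complex.slitPlane) :
    ∃ s ∈ 𝓝 z₀, ∃ c > 0, ∀ z ∈ s, ∀ t ∈ Icc (0 : ℝ) 1, c ≤ ‖1 - z * t‖ := by
  have hopen : IsOpen {z : ℂ | 1 - z ∈ Complex.slitPlane} :=
    Complex.isOpen_slitPlane.preimage (by fun_prop)
  obtain ⟨ε, hε, hs⟩ := Metric.nhds_basis_closedBall.mem_iff.1 (hopen.mem_nhds hz₀)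
  have hcompact : IsCompact (Metric.closedBall z₀ ε ×ˢ Icc (0 : ℝ) 1) :=
    (isCompact_closedBall _ _).prod isCompact_Icc
  obtain ⟨p, hp, hmin⟩ := hcompact.exists_isMinOn ⟨(z₀, 0), by simp [hε.le]⟩
    (f := fun p : ℂ × ℝ => ‖1 - p.1 * p.2‖) (by fun_prop)
  refine ⟨Metric.closedBall z₀ ε, Metric.closedBall_mem_nhds _ hε, ‖1 - p.1 * p.2‖, ?_,
    fun z hz t ht => hmin (a := (z, t)) ⟨hz, ht⟩⟩
  exact norm_pos_iff.2 (Complex.slitPlane_ne_zero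
    (one_sub_mul_ofReal_mem_slitPlane (hs hp.1) hp.2))

variable {X : Type*} [MeasurableSpace X] {μ : Measure X} {f : X → ℝ}

/-- The generating function `∑ zⁿ ∫ fⁿ⁺¹ ∂μ` of the moments of a `[0, 1]`-valued function `f`, in
the closed form which continues it analytically to the plane cut along `[1, ∞)`. -/
def momentTransform (μ : Measure X) (f : X → ℝ) (z : ℂ) : ℂ :=
  ∫ x, (f x : ℂ) / (1 - z * f x) ∂μ

theorem differentiableAt_momentTransform (hf : Integrable f μ) (hf01 : ∀ᵐ x ∂μ, f x ∈ Icc 0 1)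
    {z₀ : ℂ} (hz₀ : 1 - z₀ ∈ Complex.slitPlane) :
    DifferentiableAt ℂ (momentTransform μ f) z₀ := by
  obtain ⟨s, hs, c, hc, hbound⟩ := exists_le_norm_one_sub_mul_ofReal hz₀
  have hfm : AEMeasurable f μ := hf.aemeasurable
  have hmeas : ∀ z : ℂ, AEStronglyMeasurable (fun x => (f x : ℂ) / (1 - z * f x)) μ := fun z =>
    (AEMeasurable.aestronglyMeasurable (by fun_prop))
  have hmeas' : AEStronglyMeasurable (fun x => (f x : ℂ) ^ 2 / (1 - z₀ * f x) ^ 2) μ :=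
    AEMeasurable.aestronglyMeasurable (by fun_prop)
  have hint : Integrable (fun x => (f x : ℂ) / (1 - z₀ * f x)) μ := by
    refine (hf.div_const c).mono' (hmeas z₀) (hf01.mono fun x hx => ?_)
    rw [norm_div, Complex.norm_real, Real.norm_of_nonneg hx.1]
    gcongr
    exacts [hx.1, hbound z₀ (mem_of_mem_nhds hs) _ hx]
  refine (hasDerivAt_integral_of_dominated_loc_of_deriv_le
    (F' := fun z x => (f x : ℂ) ^ 2 / (1 - z * f x) ^ 2) (bound := fun x => f x / c ^ 2)
    hs (Eventually.of_forall hmeas) hint hmeas' (hf01.mono fun x hx z hz => ?_)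
    (hf.div_const _) (hf01.mono fun x hx z hz => ?_)).2.differentiableAt
  · rw [norm_div, norm_pow, norm_pow, Complex.norm_real, Real.norm_of_nonneg hx.1]
    have := hbound z hz _ hx
    gcongr
    · exact hx.1
    · exact pow_le_of_le_one hx.1 hx.2 two_ne_zero
  · have hne : 1 - z * (f x : ℂ) ≠ 0 := norm_pos_iff.1 (hc.trans_le (hbound z hz _ hx))
    have hderiv := ((((hasDerivAt_id z).mul_const (f x : ℂ)).const_sub 1).inv hne).const_mul
      (f x : ℂ)
    simp only [id, one_mul, neg_neg] at hderiv
    convert! hderiv using 1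
    field_simp

theorem hasSum_momentTransform (hf : Integrable f μ) (hf01 : ∀ᵐ x ∂μ, f x ∈ Icc 0 1)
    {z : ℂ} (hz : ‖z‖ < 1) :
    HasSum (fun n : ℕ => z ^ n * (∫ x, f x ^ (n + 1) ∂μ : ℝ)) (momentTransform μ f z) := by
  have hle : ∀ n : ℕ, ∀ᵐ x ∂μ, ‖f x ^ (n + 1)‖ ≤ f x := fun n => hf01.mono fun x hx => by
    rw [norm_pow, Real.norm_of_nonneg hx.1]
    exact pow_le_of_le_one hx.1 hx.2 n.succ_ne_zero
  have hint : ∀ n : ℕ, Integrable (fun x => f x ^ (n + 1)) μ := fun n =>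
    hf.mono' (hf.aestronglyMeasurable.pow _) (hle n)
  have hsummable : Summable fun n : ℕ => ∫ x, ‖z ^ n * ((f x ^ (n + 1) : ℝ) : ℂ)‖ ∂μ := by
    refine .of_nonneg_of_le (fun n => integral_nonneg fun x => norm_nonneg _) (fun n => ?_)
      ((summable_geometric_of_lt_one (norm_nonneg z) hz).mul_right (∫ x, f x ∂μ))
    simp only [norm_mul, norm_pow z, Complex.norm_real, integral_const_mul]
    exact mul_le_mul_of_nonneg_left (integral_mono_ae (hint n).norm hf (hle n)) (by positivity)
  have hgeom : ∀ᵐ x ∂μ, ∑' n : ℕ, z ^ n * ((f x ^ (n + 1) : ℝ) : ℂ) =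
      (f x : ℂ) / (1 - z * f x) := hf01.mono fun x hx => by
    have hlt : ‖z * (f x : ℂ)‖ < 1 := by
      rw [norm_mul, Complex.norm_real, Real.norm_of_nonneg hx.1]
      exact (mul_le_of_le_one_right (norm_nonneg z) hx.2).trans_lt hz
    rw [div_eq_mul_inv, ← tsum_geometric_of_norm_lt_one hlt, ← tsum_mul_left]
    refine tsum_congr fun n => ?_
    push_cast
    ring
  have hsum := hasSum_integral_of_summable_integral_norm
    (F := fun (n : ℕ) x => z ^ n * ((f x ^ (n + 1) : ℝ) : ℂ))
    (fun n => (hint n).ofReal.const_mul (z ^ n)) hsummable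
  rw [integral_congr_ae hgeom] at hsum
  simp only [integral_const_mul, integral_complex_ofReal] at hsum
  exact hsum

variable {b : ℝ}

theorem rpow_neg_mem_Icc (hb : 0 ≤ b) {u : ℝ} (hu : 1 ≤ u) : u ^ (-b) ∈ Icc (0 : ℝ) 1 :=
  ⟨by positivity, Real.rpow_le_one_of_one_le_of_nonpos hu (neg_nonpos.2 hb)⟩

theorem ae_rpow_neg_mem_Icc (hb : 0 ≤ b) :
    ∀ᵐ u ∂volume.restrict (Ioi (1 : ℝ)), u ^ (-b) ∈ Icc (0 : ℝ) 1 :=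
  ae_restrict_of_forall_mem measurableSet_Ioi fun _ hu => rpow_neg_mem_Icc hb (le_of_lt hu)

theorem integral_Ioi_one_rpow_neg_pow (hb : 1 < b) (n : ℕ) :
    ∫ u in Ioi (1 : ℝ), (u ^ (-b)) ^ (n + 1) = 1 / ((n + 1) * b - 1) := by
  have hpow : ∀ u ∈ Ioi (1 : ℝ), (u ^ (-b)) ^ (n + 1) = u ^ (-((n + 1) * b)) := fun u hu => by
    rw [← Real.rpow_natCast, ← Real.rpow_mul (zero_le_one.trans (le_of_lt hu))]
    push_cast
    ring_nf
  have hlt : -(((n : ℝ) + 1) * b) < -1 := by nlinarith [n.cast_nonneg (α := ℝ)]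
  rw [setIntegral_congr_fun measurableSet_Ioi hpow, integral_Ioi_rpow_of_lt hlt one_pos,
    Real.one_rpow, ← neg_div_neg_eq]
  ring_nf

theorem isGaussHypergeometric_one_sub_mul_momentTransform (hb : 1 < b) :
    IsGaussHypergeometric 1 ((-b⁻¹ : ℝ) : ℂ) ((1 - b⁻¹ : ℝ) : ℂ) fun z =>
      1 - z * momentTransform (volume.restrict (Ioi (1 : ℝ))) (fun u => u ^ (-b)) z := by
  have hb0 : 0 < b := one_pos.trans hb
  have hint : IntegrableOn (fun u : ℝ => u ^ (-b)) (Ioi 1) :=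
    integrableOn_Ioi_rpow_of_lt (neg_lt_neg hb) one_pos
  refine ⟨fun z hz => ((differentiableAt_const _).sub (differentiableAt_id.mul
    (differentiableAt_momentTransform hint (ae_rpow_neg_mem_Icc hb0.le)
      hz))).differentiableWithinAt, fun z hz => ?_⟩
  have hden : ∀ n : ℕ, ((n : ℝ) + 1) * b - 1 ≠ 0 := fun n => by
    nlinarith [n.cast_nonneg (α := ℝ)]
  have hbC : (b : ℂ) ≠ 0 := by exact_mod_cast hb0.ne'
  have hne : ∀ n : ℕ, ((-b⁻¹ : ℝ) : ℂ) + n ≠ 0 := by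
    rintro (_ | n)
    · simpa using hb0.ne'
    · have := hden n
      rw [← Complex.ofReal_natCast, ← Complex.ofReal_add, Complex.ofReal_ne_zero]
      push_cast
      contrapose! this
      field_simp at this
      linear_combination this
  have hparam : ((1 - b⁻¹ : ℝ) : ℂ) = ((-b⁻¹ : ℝ) : ℂ) + 1 := by push_cast; ring
  rw [hparam, ordinaryHypergeometric_one_eq_tsum hne]
  refine ((hasSum_nat_add_iff' 1).1 ?_).tsum_eq.symm
  convert! (hasSum_momentTransform hint (ae_rpow_neg_mem_Icc hb0.le) hz).mul_left (-z) using 1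
  · ext n
    have hshift := hne (n + 1)
    have : ((n : ℂ) + 1) * b - 1 ≠ 0 := by exact_mod_cast hden n
    rw [integral_Ioi_one_rpow_neg_pow hb]
    push_cast at hshift ⊢
    field_simp
    ring
  · simp [hbC]

/-- The expected share of signal power lost, under Rayleigh fading, to an interferer whose squared
distance to the receiver exceeds that of the transmitter by the factor `u`; here `b` is half the
path loss exponent. -/
def interferenceKernel (b θ u : ℝ) : ℝ := θ * u ^ (-b) / (1 + θ * u ^ (-b))

theorem eta_one_one {α θ : ℝ} (hα : 2 < α) (hθ : 0 < θ) :
    eta α θ 1 1 = 1 + ∫ u in Ioi (1 : ℝ), interferenceKernel (α / 2) θ u := by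
  have hslit : 1 - ((-θ : ℝ) : ℂ) ∈ Complex.slitPlane := by
    rw [← Complex.ofReal_one, ← Complex.ofReal_sub, Complex.ofReal_mem_slitPlane]
    linarith
  have hgauss := (isGaussHypergeometric_one_sub_mul_momentTransform
    (b := α / 2) (by linarith)).gaussHypergeometric_eq hslit
  have hkernel : ((-θ : ℝ) : ℂ) *
      momentTransform (volume.restrict (Ioi (1 : ℝ))) (fun u => u ^ (-(α / 2))) ((-θ : ℝ) : ℂ) =
      ((-∫ u in Ioi (1 : ℝ), interferenceKernel (α / 2) θ u : ℝ) : ℂ) := by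
    rw [momentTransform, ← integral_neg, ← integral_complex_ofReal, ← integral_const_mul]
    congr 1
    ext u
    unfold interferenceKernel
    push_cast
    ring
  rw [inv_div] at hgauss
  rw [eta, Nat.cast_one, Real.one_rpow, Nat.cast_one, mul_one, div_one, hgauss, hkernel,
    Complex.sub_re, Complex.one_re, Complex.ofReal_re, sub_neg_eq_add]

end Hypergeometric

section Kernel

variable {b θ u : ℝ}

theorem interferenceKernel_nonneg (hθ : 0 ≤ θ) (hu : 0 ≤ u) : 0 ≤ interferenceKernel b θ u := by
  unfold interferenceKernel
  positivity

theorem interferenceKernel_pos (hθ : 0 < θ) (hu : 0 < u) : 0 < interferenceKernel b θ u := by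
  unfold interferenceKernel
  positivity

theorem interferenceKernel_le_one (hθ : 0 ≤ θ) (hu : 0 ≤ u) : interferenceKernel b θ u ≤ 1 := by
  have : 0 ≤ θ * u ^ (-b) := by positivity
  exact div_le_one_of_le₀ (by linarith) (by linarith)

@[fun_prop]
theorem measurable_interferenceKernel (b θ : ℝ) : Measurable (interferenceKernel b θ) := by
  unfold interferenceKernel
  fun_prop

theorem integrableOn_interferenceKernel (hb : 1 < b) (hθ : 0 ≤ θ) {ρ : ℝ} (hρ : 0 < ρ) :
    IntegrableOn (interferenceKernel b θ) (Ioi ρ) := by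
  refine ((integrableOn_Ioi_rpow_of_lt (neg_lt_neg hb) hρ).const_mul θ).mono'
    (by fun_prop) (ae_restrict_of_forall_mem measurableSet_Ioi fun u hu => ?_)
  have hu0 : 0 ≤ u := hρ.le.trans (le_of_lt hu)
  rw [Real.norm_of_nonneg (interferenceKernel_nonneg hθ hu0)]
  exact div_le_self (by positivity) (le_add_of_nonneg_right (by positivity))

theorem integral_interferenceKernel_pos (hb : 1 < b) (hθ : 0 < θ) :
    0 < ∫ u in Ioi (1 : ℝ), interferenceKernel b θ u := by
  rw [setIntegral_pos_iff_support_of_nonneg_ae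
    (ae_restrict_of_forall_mem measurableSet_Ioi fun u hu =>
      interferenceKernel_nonneg hθ.le (one_pos.le.trans (le_of_lt hu)))
    (integrableOn_interferenceKernel hb hθ.le one_pos)]
  have : Function.support (interferenceKernel b θ) ∩ Ioi 1 = Ioi 1 :=
    inter_eq_right.2 fun u hu => (interferenceKernel_pos hθ (one_pos.trans hu)).ne'
  simp [this]

theorem one_lt_eta_one_one {α : ℝ} (hα : 2 < α) (hθ : 0 < θ) : 1 < eta α θ 1 1 := by
  rw [eta_one_one hα hθ, lt_add_iff_pos_right]
  exact integral_interferenceKernel_pos (by linarith) hθ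

theorem integral_interferenceKernel_sub_le (hb : 1 < b) (hθ : 0 ≤ θ) {ρ : ℝ} (hρ : 1 ≤ ρ) :
    (∫ u in Ioi (1 : ℝ), interferenceKernel b θ u) - (ρ - 1) ≤
      ∫ u in Ioi ρ, interferenceKernel b θ u := by
  have hint := integrableOn_interferenceKernel hb hθ one_pos
  rw [← Ioc_union_Ioi_eq_Ioi hρ, setIntegral_union Ioc_disjoint_Ioi_same measurableSet_Ioi
    (hint.mono_set Ioc_subset_Ioi_self) (hint.mono_set (Ioi_subset_Ioi hρ))]
  have hshort : ∫ u in Ioc 1 ρ, interferenceKernel b θ u ≤ ∫ _ in Ioc 1 ρ, (1 : ℝ) :=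
    setIntegral_mono_on (hint.mono_set Ioc_subset_Ioi_self) (integrableOn_const (by simp))
      measurableSet_Ioc fun u hu => interferenceKernel_le_one hθ (one_pos.le.trans hu.1.le)
  simp only [setIntegral_const, smul_eq_mul, mul_one, Real.volume_real_Ioc_of_le hρ] at hshort
  linarith

end Kernel

section Maximisation

theorem mul_exp_neg_mul_lt {a l : ℝ} (ha : 0 < a) (hne : l ≠ 1 / a) :
    l * Real.exp (-(a * l)) < 1 / a * Real.exp (-1) := by
  have hal : a * l - 1 ≠ 0 := fun h => hne (by field_simp; linarith)
  have hlt := Real.add_one_lt_exp hal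
  rw [sub_add_cancel, sub_eq_neg_add, Real.exp_add] at hlt
  rw [Real.exp_neg (a * l), ← div_eq_mul_inv, div_lt_iff₀ (Real.exp_pos _), one_div, mul_assoc,
    lt_inv_mul_iff₀ ha]
  exact hlt

theorem setOf_isMaxOn_mul_exp_neg {a K : ℝ} (ha : 0 < a) (hK : 0 < K) {f : ℝ → ℝ}
    (hf : ∀ l, 0 < l → f l = l * Real.exp (-(a * l)) * K) :
    {l : ℝ | l ∈ Ioi 0 ∧ IsMaxOn f (Ioi 0) l} = {1 / a} := by
  have ha' : 0 < 1 / a := by positivity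
  have hlt : ∀ l, 0 < l → l ≠ 1 / a → f l < f (1 / a) := fun l hl hne => by
    rw [hf l hl, hf _ ha', mul_one_div_cancel ha.ne']
    exact mul_lt_mul_of_pos_right (mul_exp_neg_mul_lt ha hne) hK
  ext l
  constructor
  · rintro ⟨hl, hmax⟩
    by_contra hne
    exact (hlt l hl hne).not_ge (hmax ha')
  · rintro rfl
    refine ⟨ha', fun l hl => ?_⟩
    rcases eq_or_ne l (1 / a) with rfl | hne
    exacts [le_refl (f _), (hlt l hl hne).le]

end Maximisation

section NegExp

/-- The function `t ↦ exp (-t)` on `[0, ∞]`, with value `0` at `∞`: the integrand of Laplace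
transforms of sums which may diverge. -/
def negExp (t : ℝ≥0∞) : ℝ≥0∞ := EReal.exp (-(t : EReal))

theorem continuous_negExp : Continuous negExp :=
  ENNReal.continuous_exp.comp (continuous_neg.comp continuous_coe_ennreal_ereal)

@[fun_prop]
theorem measurable_negExp : Measurable negExp := continuous_negExp.measurable

theorem antitone_negExp : Antitone negExp := fun _ _ hst =>
  EReal.exp_monotone (EReal.neg_le_neg_iff.2 (EReal.coe_ennreal_le_coe_ennreal_iff.2 hst))

@[simp] theorem negExp_zero : negExp 0 = 1 := by simp [negExp]

@[simp] theorem negExp_top : negExp ∞ = 0 := by simp [negExp]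

theorem negExp_le_one (t : ℝ≥0∞) : negExp t ≤ 1 := negExp_zero ▸ antitone_negExp zero_le

theorem negExp_ne_top (t : ℝ≥0∞) : negExp t ≠ ∞ :=
  ((negExp_le_one t).trans_lt ENNReal.one_lt_top).ne

theorem negExp_ofReal {x : ℝ} (hx : 0 ≤ x) :
    negExp (ENNReal.ofReal x) = ENNReal.ofReal (Real.exp (-x)) := by
  rw [negExp, EReal.coe_ennreal_ofReal, max_eq_left hx, ← EReal.coe_neg, EReal.exp_coe]

theorem negExp_add (s t : ℝ≥0∞) : negExp (s + t) = negExp s * negExp t := by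
  have hne : ∀ t : ℝ≥0∞, EReal.exp (t : EReal) ≠ 0 := fun t h =>
    EReal.coe_ennreal_ne_bot t (EReal.exp_eq_zero_iff.1 h)
  rw [negExp, negExp, negExp, EReal.exp_neg, EReal.exp_neg, EReal.exp_neg, EReal.coe_ennreal_add,
    EReal.exp_add, ENNReal.mul_inv (Or.inl (hne s)) (Or.inr (hne t))]

theorem negExp_sum {ι : Type*} (s : Finset ι) (f : ι → ℝ≥0∞) :
    negExp (∑ i ∈ s, f i) = ∏ i ∈ s, negExp (f i) := by
  induction s using Finset.cons_induction with
  | empty => simp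
  | cons a s ha ih => rw [Finset.sum_cons, Finset.prod_cons, negExp_add, ih]

theorem negExp_mul_natCast (t : ℝ≥0∞) (n : ℕ) : negExp (t * n) = negExp t ^ n := by
  simpa [mul_comm] using negExp_sum (Finset.range n) fun _ => t

theorem tendsto_lintegral_negExp {Ω ι : Type*} [MeasurableSpace Ω] {P : Measure Ω}
    [IsFiniteMeasure P] {l : Filter ι} [l.IsCountablyGenerated] {X : ι → Ω → ℝ≥0∞}
    {Y : Ω → ℝ≥0∞} (hX : ∀ i, Measurable (X i)) (hlim : ∀ ω, Tendsto (X · ω) l (𝓝 (Y ω))) :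
    Tendsto (fun i => ∫⁻ ω, negExp (X i ω) ∂P) l (𝓝 (∫⁻ ω, negExp (Y ω) ∂P)) :=
  tendsto_lintegral_filter_of_dominated_convergence (fun _ => 1)
    (.of_forall fun i => measurable_negExp.comp (hX i))
    (.of_forall fun i => .of_forall fun ω => negExp_le_one _) (by simp)
    (.of_forall fun ω => (continuous_negExp.tendsto _).comp (hlim ω))

end NegExp

section RayleighFading

theorem expMeasure_one_setOf_lt_ofReal (t : ℝ≥0∞) :
    expMeasure 1 {y | t < ENNReal.ofReal y} = negExp t := by
  have := isProbabilityMeasure_expMeasure one_pos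
  induction t with
  | top => simp
  | coe t =>
    have hset : {y : ℝ | (t : ℝ≥0∞) < ENNReal.ofReal y} = (Iic (t : ℝ))ᶜ := by
      ext y
      rw [mem_ofPred_eq, ← ENNReal.ofReal_coe_nnreal, compl_Iic, mem_Ioi]
      exact ENNReal.ofReal_lt_ofReal_iff_of_nonneg t.coe_nonneg
    rw [hset, prob_compl_eq_one_sub measurableSet_Iic, ← ofReal_cdf, cdf_expMeasure_eq one_pos,
      if_pos t.coe_nonneg, ← ENNReal.ofReal_one, ← ENNReal.ofReal_sub _ (by simp),
      ← ENNReal.ofReal_coe_nnreal, negExp_ofReal t.coe_nonneg, one_mul, sub_sub_cancel]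

theorem lintegral_negExp_mul_expMeasure_one {w : ℝ} (hw : 0 ≤ w) :
    ∫⁻ y, negExp (ENNReal.ofReal (w * y)) ∂expMeasure 1 =
      negExp (ENNReal.ofReal (Real.log (1 + w))) := by
  have hw1 : 0 < 1 + w := by linarith
  have htilt : ∀ y : ℝ, exponentialPDF 1 y * negExp (ENNReal.ofReal (w * y)) =
      ENNReal.ofReal (1 + w)⁻¹ * exponentialPDF (1 + w) y := fun y => by
    rcases lt_or_ge y 0 with hy | hy
    · rw [exponentialPDF_of_neg hy, exponentialPDF_of_neg hy, zero_mul, mul_zero]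
    · rw [exponentialPDF_of_nonneg hy, exponentialPDF_of_nonneg hy,
        negExp_ofReal (mul_nonneg hw hy), ← ENNReal.ofReal_mul (by positivity),
        ← ENNReal.ofReal_mul (by positivity), one_mul, ← Real.exp_add,
        inv_mul_cancel_left₀ hw1.ne']
      ring_nf
  have hpdf : ∀ r, Measurable (exponentialPDF r) := fun r =>
    (measurable_exponentialPDFReal r).ennreal_ofReal
  have hdens : expMeasure 1 = volume.withDensity (exponentialPDF 1) := rfl
  rw [hdens, lintegral_withDensity_eq_lintegral_mul _ (hpdf 1)
    (g := fun y => negExp (ENNReal.ofReal (w * y))) (by fun_prop)]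
  simp only [Pi.mul_apply, htilt]
  rw [lintegral_const_mul _ (hpdf _), lintegral_exponentialPDF_eq_one hw1, mul_one,
    negExp_ofReal (Real.log_nonneg (by linarith)), Real.exp_neg, Real.exp_log hw1]

variable {Ω ι : Type*} [MeasurableSpace Ω] {P : Measure Ω} {X : Ω → ℝ} {T : Ω → ℝ≥0∞}
  {g : ι → Ω → ℝ} {w : ι → ℝ}

theorem measure_lt_ofReal_eq_lintegral_negExp [IsFiniteMeasure P] (hX : Measurable X)
    (hlaw : P.map X = expMeasure 1) (hT : Measurable T) (hind : IndepFun T X P) :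
    P {ω | T ω < ENNReal.ofReal (X ω)} = ∫⁻ ω, negExp (T ω) ∂P := by
  have hS : MeasurableSet {p : ℝ≥0∞ × ℝ | p.1 < ENNReal.ofReal p.2} :=
    measurableSet_lt measurable_fst measurable_snd.ennreal_ofReal
  have := isProbabilityMeasure_expMeasure one_pos
  calc P {ω | T ω < ENNReal.ofReal (X ω)}
      = P.map (fun ω => (T ω, X ω)) {p | p.1 < ENNReal.ofReal p.2} :=
        (Measure.map_apply (hT.prodMk hX) hS).symm
    _ = ∫⁻ t, expMeasure 1 {y | t < ENNReal.ofReal y} ∂P.map T := by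
        rw [hind.map_prod_eq_prod_map_map hT.aemeasurable hX.aemeasurable, hlaw,
          Measure.prod_apply hS]
        rfl
    _ = ∫⁻ ω, negExp (T ω) ∂P := by
        simp_rw [expMeasure_one_setOf_lt_ofReal]
        exact lintegral_map measurable_negExp hT

theorem measurable_tsum_ofReal_mul [Countable ι] (hg : ∀ i, Measurable (g i)) (w : ι → ℝ) :
    Measurable fun ω => ∑' i, ENNReal.ofReal (w i * g i ω) :=
  .tsum fun i => ((hg i).const_mul _).ennreal_ofReal

theorem lintegral_negExp_tsum_ofReal_mul [Countable ι] (hg : ∀ i, Measurable (g i))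
    (hlaw : ∀ i, P.map (g i) = expMeasure 1) (hind : iIndepFun g P) (hw : ∀ i, 0 ≤ w i) :
    ∫⁻ ω, negExp (∑' i, ENNReal.ofReal (w i * g i ω)) ∂P =
      negExp (∑' i, ENNReal.ofReal (Real.log (1 + w i))) := by
  have := hind.isProbabilityMeasure
  have hterm : ∀ i, Measurable fun y : ℝ => negExp (ENNReal.ofReal (w i * y)) := by fun_prop
  have hfinite : ∀ s : Finset ι, ∫⁻ ω, negExp (∑ i ∈ s, ENNReal.ofReal (w i * g i ω)) ∂P =
      negExp (∑ i ∈ s, ENNReal.ofReal (Real.log (1 + w i))) := fun s => by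
    simp_rw [negExp_sum]
    rw [lintegral_prod_eq_prod_lintegral_of_indepFun s
      (fun i ω => negExp (ENNReal.ofReal (w i * g i ω))) (hind.comp _ hterm)
      (fun i => (hterm i).comp (hg i))]
    refine Finset.prod_congr rfl fun i _ => ?_
    rw [← lintegral_negExp_mul_expMeasure_one (hw i), ← hlaw i, lintegral_map (hterm i) (hg i)]
  have hlim : Tendsto (fun s : Finset ι =>
      ∫⁻ ω, negExp (∑ i ∈ s, ENNReal.ofReal (w i * g i ω)) ∂P) atTop
      (𝓝 (∫⁻ ω, negExp (∑' i, ENNReal.ofReal (w i * g i ω)) ∂P)) :=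
    tendsto_lintegral_negExp
      (fun s => Finset.measurable_sum _ fun i _ => ((hg i).const_mul _).ennreal_ofReal)
      fun ω => ENNReal.summable.hasSum
  simp_rw [hfinite] at hlim
  exact tendsto_nhds_unique hlim ((continuous_negExp.tendsto _).comp ENNReal.summable.hasSum)

theorem indepFun_tsum_ofReal_mul_ne [Countable ι] (hg : ∀ i, Measurable (g i))
    (hind : iIndepFun g P) (w : ι → ℝ) (i : ι) :
    IndepFun (fun ω => ∑' j : {j // j ≠ i}, ENNReal.ofReal (w j * g j ω)) (g i) P := by
  rw [IndepFun_iff_Indep]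
  have hsplit := indep_iSup_of_disjoint (fun j => (hg j).comap_le) hind.iIndep
    (S := {j | j ≠ i}) (T := {i}) (by simp)
  refine indep_of_indep_of_le_right (indep_of_indep_of_le_left hsplit ?_) (by simp)
  refine Measurable.comap_le (@measurable_tsum_ofReal_mul Ω {j // j ≠ i}
    (⨆ k ∈ {j | j ≠ i}, MeasurableSpace.comap (g k) inferInstance) (fun j => g j) _
    (fun j => ?_) fun j => w j)
  exact (comap_measurable (g j)).mono (le_iSup₂_of_le j.1 j.2 le_rfl) le_rfl

theorem measure_tsum_ofReal_mul_lt_ofReal [Countable ι] (hg : ∀ i, Measurable (g i))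
    (hlaw : ∀ i, P.map (g i) = expMeasure 1) (hind : iIndepFun g P) (hw : ∀ i, 0 ≤ w i) (i : ι) :
    P {ω | ∑' j : {j // j ≠ i}, ENNReal.ofReal (w j * g j ω) < ENNReal.ofReal (g i ω)} =
      negExp (∑' j : {j // j ≠ i}, ENNReal.ofReal (Real.log (1 + w j))) := by
  have := hind.isProbabilityMeasure
  rw [measure_lt_ofReal_eq_lintegral_negExp (hg i) (hlaw i)
    (measurable_tsum_ofReal_mul (fun j : {j // j ≠ i} => hg j) fun j => w j)
    (indepFun_tsum_ofReal_mul_ne hg hind w i)]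
  exact lintegral_negExp_tsum_ofReal_mul (fun j : {j // j ≠ i} => hg j) (fun j => hlaw j)
    (hind.precomp Subtype.val_injective) (fun j => hw j)

end RayleighFading

section PoissonMeasure

variable (r : ℝ≥0)

theorem lintegral_poissonMeasure (f : ℕ → ℝ≥0∞) :
    ∫⁻ k, f k ∂poissonMeasure r =
      ∑' k, f k * ENNReal.ofReal (Real.exp (-r) * r ^ k / k.factorial) := by
  simp_rw [lintegral_countable', poissonMeasure_singleton]

theorem lintegral_pow_poissonMeasure {q : ℝ} (hq : 0 ≤ q) :
    ∫⁻ k, ENNReal.ofReal q ^ k ∂poissonMeasure r =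
      ENNReal.ofReal (Real.exp (-(r * (1 - q)))) := by
  have hterm : ∀ k : ℕ, ENNReal.ofReal q ^ k *
      ENNReal.ofReal (Real.exp (-r) * r ^ k / k.factorial) =
      ENNReal.ofReal (Real.exp (-r) * ((r * q) ^ k / k.factorial)) := fun k => by
    rw [← ENNReal.ofReal_pow hq, ← ENNReal.ofReal_mul (by positivity)]
    ring_nf
  have hexp : HasSum (fun k : ℕ => (r * q) ^ k / k.factorial) (Real.exp (r * q)) := by
    rw [Real.exp_eq_exp_ℝ]
    exact NormedSpace.expSeries_div_hasSum_exp _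
  rw [lintegral_poissonMeasure]
  simp_rw [hterm]
  rw [← ENNReal.ofReal_tsum_of_nonneg (fun k => by positivity) (hexp.mul_left _).summable,
    (hexp.mul_left _).tsum_eq, ← Real.exp_add]
  ring_nf

theorem lintegral_negExp_mul_poissonMeasure (c : ℝ≥0∞) :
    ∫⁻ k, negExp (c * k) ∂poissonMeasure r = negExp (r * (1 - negExp c)) := by
  simp_rw [negExp_mul_natCast]
  have hq1 := negExp_le_one c
  lift negExp c to ℝ≥0 using negExp_ne_top c with q
  replace hq1 : (q : ℝ) ≤ 1 := by exact_mod_cast hq1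
  have hloss : (r : ℝ≥0∞) * (1 - q) = ENNReal.ofReal (r * (1 - q)) := by
    rw [ENNReal.ofReal_mul r.coe_nonneg, ENNReal.ofReal_sub _ q.coe_nonneg,
      ENNReal.ofReal_coe_nnreal, ENNReal.ofReal_coe_nnreal, ENNReal.ofReal_one]
  rw [hloss, negExp_ofReal (mul_nonneg r.coe_nonneg (sub_nonneg.2 hq1)),
    ← lintegral_pow_poissonMeasure r q.coe_nonneg, ENNReal.ofReal_coe_nnreal]

end PoissonMeasure

section PointCount

variable {E : Type*}

/-- The number of terms of the sequence `x` which lie in `B`. -/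
def pointCount (x : ℕ → E) (B : Set E) : ℕ∞ := {i : ℕ | x i ∈ B}.encard

theorem pointCount_eq_zero_iff {x : ℕ → E} {B : Set E} : pointCount x B = 0 ↔ ∀ i, x i ∉ B := by
  rw [pointCount, encard_eq_zero, eq_empty_iff_forall_notMem]
  rfl

variable [MeasurableSpace E]

theorem map_count_apply (x : ℕ → E) {B : Set E} (hB : MeasurableSet B) :
    (Measure.count.map x) B = pointCount x B := by
  rw [Measure.map_apply (measurable_of_countable x) hB, Measure.count_apply (.of_discrete)]
  rfl

theorem measurable_pointCount {Ω : Type*} [MeasurableSpace Ω] {x : ℕ → Ω → E}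
    (hx : ∀ i, Measurable (x i)) {B : Set E} (hB : MeasurableSet B) :
    Measurable fun ω => pointCount (x · ω) B := by
  have hsum : ∀ ω, (pointCount (x · ω) B : ℝ≥0∞) =
      ∑' i, (x i ⁻¹' B).indicator (fun _ => 1) ω := fun ω => by
    rw [pointCount, ← ENNReal.tsum_set_one]
    exact tsum_subtype {i : ℕ | x i ω ∈ B} 1
  have hmeas : Measurable fun ω => (pointCount (x · ω) B : ℝ≥0∞) := by
    simp_rw [hsum]
    exact .tsum fun i => measurable_const.indicator (hx i hB)
  refine ENat.measurable_iff.2 fun n => ?_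
  convert! hmeas (measurableSet_singleton (n : ℝ≥0∞)) using 1
  ext ω
  simp only [mem_preimage, mem_singleton_iff]
  norm_cast

theorem tsum_comp_eq_sum_mul_pointCount (f : SimpleFunc E ℝ≥0∞) (x : ℕ → E) :
    ∑' i, f (x i) = ∑ c : f.range.erase 0, c.1 * pointCount x (f ⁻¹' {c.1}) := by
  rw [Finset.sum_coe_sort _ fun c => c * (pointCount x (f ⁻¹' {c}) : ℝ≥0∞),
    Finset.sum_erase _ (zero_mul _), ← lintegral_count, ← lintegral_map f.measurable
    (measurable_of_countable x), SimpleFunc.lintegral_eq_lintegral]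
  exact Finset.sum_congr rfl fun c _ => by rw [map_count_apply x (f.measurableSet_fiber c)]

theorem measurableSet_pointCount_eq {Ω : Type*} [MeasurableSpace Ω] {x : ℕ → Ω → E}
    (hx : ∀ i, Measurable (x i)) {B : Set E} (hB : MeasurableSet B) (n : ℕ∞) :
    MeasurableSet {ω | pointCount (x · ω) B = n} :=
  measurable_pointCount hx hB (measurableSet_singleton n)

end PointCount

section PoissonPointProcess

variable {Ω : Type*} [MeasurableSpace Ω] {P : Measure Ω} {lam : ℝ}
  {x : ℕ → Ω → EuclideanSpace ℝ (Fin 2)}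

namespace IsPoissonPointProcess

theorem isProbabilityMeasure (hx : IsPoissonPointProcess lam x P) : IsProbabilityMeasure P := by
  have h := hx.law 0 (fun _ => ∅) (by simp) (by simp) (fun i => i.elim0) fun _ => 0
  exact ⟨by simpa using h⟩

variable {ι : Type*} [Fintype ι] {B : ι → Set (EuclideanSpace ℝ (Fin 2))}

theorem measure_pointCount_eq (hx : IsPoissonPointProcess lam x P)
    (hB : ∀ j, MeasurableSet (B j)) (hbdd : ∀ j, Bornology.IsBounded (B j))
    (hdisj : Pairwise (Function.onFun Disjoint B)) (k : ι → ℕ) :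
    P {ω | ∀ j, pointCount (x · ω) (B j) = k j} =
      ∏ j, poissonMeasure (lam * (volume (B j)).toReal).toNNReal {k j} := by
  let e := Fintype.equivFin ι
  rw [← e.symm.prod_comp, ← hx.law _ (fun j => B (e.symm j)) (fun j => hB _) (fun j => hbdd _)
    (hdisj.comp_of_injective e.symm.injective) fun j => k (e.symm j)]
  congr 1
  ext ω
  exact e.symm.forall_congr_right.symm

theorem lintegral_comp_pointCount (hx : IsPoissonPointProcess lam x P)
    (hB : ∀ j, MeasurableSet (B j)) (hbdd : ∀ j, Bornology.IsBounded (B j))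
    (hdisj : Pairwise (Function.onFun Disjoint B)) (F : (ι → ℕ∞) → ℝ≥0∞) :
    ∫⁻ ω, F (fun j => pointCount (x · ω) (B j)) ∂P =
      ∫⁻ k, F (fun j => k j)
        ∂Measure.pi fun j => poissonMeasure (lam * (volume (B j)).toReal).toNNReal := by
  have := hx.isProbabilityMeasure
  have hcount : Measurable fun ω j => pointCount (x · ω) (B j) :=
    measurable_pi_lambda _ fun j => measurable_pointCount hx.measurable (hB j)
  have hcast : Measurable fun (k : ι → ℕ) j => (k j : ℕ∞) := measurable_of_countable _
  set ν := Measure.pi fun j => poissonMeasure (lam * (volume (B j)).toReal).toNNReal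
  have := Measure.isProbabilityMeasure_map (μ := P) hcount.aemeasurable
  have := Measure.isProbabilityMeasure_map (μ := ν) hcast.aemeasurable
  -- The Poisson distributions have total mass one, so there is no room for infinite counts.
  have hmap : ν.map (fun k j => (k j : ℕ∞)) = P.map fun ω j => pointCount (x · ω) (B j) := by
    refine Measure.eq_of_le_of_isProbabilityMeasure (Measure.le_iff.2 fun s hs => ?_)
    rw [← Measure.tsum_indicator_apply_singleton _ s hs,
      ← Measure.tsum_indicator_apply_singleton _ s hs]
    refine ENNReal.tsum_le_tsum fun a => indicator_le_indicator ?_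
    rw [Measure.map_apply hcast (measurableSet_singleton a),
      Measure.map_apply hcount (measurableSet_singleton a)]
    by_cases ha : ∃ k : ι → ℕ, (fun j => (k j : ℕ∞)) = a
    · obtain ⟨k, rfl⟩ := ha
      have hpre : (fun (k : ι → ℕ) j => (k j : ℕ∞)) ⁻¹' {fun j => (k j : ℕ∞)} = {k} := by
        ext l
        simp [funext_iff]
      rw [hpre, Measure.pi_singleton, ← hx.measure_pointCount_eq hB hbdd hdisj k]
      exact measure_mono fun ω hω => funext hω
    · have hempty : (fun (k : ι → ℕ) j => (k j : ℕ∞)) ⁻¹' {a} = ∅ :=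
        eq_empty_of_forall_notMem fun k hk => ha ⟨k, hk⟩
      simp [hempty]
  rw [← lintegral_map (measurable_of_countable F) hcount, ← hmap,
    lintegral_map (measurable_of_countable F) hcast]

theorem lintegral_prod_comp_pointCount (hx : IsPoissonPointProcess lam x P)
    (hB : ∀ j, MeasurableSet (B j)) (hbdd : ∀ j, Bornology.IsBounded (B j))
    (hdisj : Pairwise (Function.onFun Disjoint B)) (F : ι → ℕ∞ → ℝ≥0∞) :
    ∫⁻ ω, ∏ j, F j (pointCount (x · ω) (B j)) ∂P =
      ∏ j, ∫⁻ k : ℕ, F j k ∂poissonMeasure (lam * (volume (B j)).toReal).toNNReal := by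
  have hF : ∀ j, Measurable fun k : ℕ => F j k := fun j => measurable_of_countable _
  rw [hx.lintegral_comp_pointCount hB hbdd hdisj fun a => ∏ j, F j (a j),
    lintegral_prod_eq_prod_lintegral_of_indepFun Finset.univ
      (fun j (k : ι → ℕ) => F j (k j)) (iIndepFun_pi fun j => (hF j).aemeasurable)
      fun j => (hF j).comp (measurable_pi_apply j)]
  refine Finset.prod_congr rfl fun j _ => ?_
  exact (measurePreserving_eval (fun j => poissonMeasure (lam * (volume (B j)).toReal).toNNReal)
    j).lintegral_comp (hF j)

end IsPoissonPointProcess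

end PoissonPointProcess

section LaplaceFunctional

theorem coe_toNNReal_mul_toReal {v : ℝ≥0∞} (lam : ℝ) (hv : v ≠ ∞) :
    ((lam * v.toReal).toNNReal : ℝ≥0∞) = ENNReal.ofReal lam * v := by
  rw [← ENNReal.ofReal, ENNReal.ofReal_mul' ENNReal.toReal_nonneg, ENNReal.ofReal_toReal hv]

theorem lintegral_one_sub_negExp_simpleFunc {E : Type*} [MeasurableSpace E]
    (f : SimpleFunc E ℝ≥0∞) (μ : Measure E) :
    ∫⁻ y, (1 - negExp (f y)) ∂μ =
      ∑ c : f.range.erase 0, (1 - negExp c) * μ (f ⁻¹' {c.1}) := by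
  have hmap := (f.map fun c => 1 - negExp c).lintegral_eq_lintegral μ
  rw [SimpleFunc.map_lintegral, ← Finset.sum_erase (a := 0) _ (by simp)] at hmap
  rw [Finset.sum_coe_sort _ fun c => (1 - negExp c) * μ (f ⁻¹' {c}), ← hmap]
  rfl

theorem exists_monotone_simpleFunc_tendsto {E : Type*} [SeminormedAddGroup E] [MeasurableSpace E]
    [OpensMeasurableSpace E] {f : E → ℝ≥0∞} (hf : Measurable f) :
    ∃ φ : ℕ → SimpleFunc E ℝ≥0∞, Monotone φ ∧
      (∀ y, Tendsto (φ · y) atTop (𝓝 (f y))) ∧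
        ∀ k, Bornology.IsBounded (Function.support (φ k)) := by
  have hball : ∀ k : ℕ, MeasurableSet (Metric.ball (0 : E) k) :=
    fun k => Metric.isOpen_ball.measurableSet
  refine ⟨fun k => (SimpleFunc.eapprox f k).restrict (Metric.ball 0 k), ?_, fun y => ?_,
    fun k => ?_⟩
  · intro k l hkl y
    rw [SimpleFunc.restrict_apply _ (hball k), SimpleFunc.restrict_apply _ (hball l)]
    exact (indicator_le_indicator_of_subset (Metric.ball_subset_ball (by exact_mod_cast hkl))
      (fun _ => zero_le) y).trans (indicator_le_indicator (SimpleFunc.monotone_eapprox f hkl y))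
  · refine (SimpleFunc.tendsto_eapprox hf y).congr' ?_
    filter_upwards [eventually_gt_atTop ⌊‖y‖⌋₊] with k hk
    rw [SimpleFunc.restrict_apply _ (hball k),
      indicator_of_mem (mem_ball_zero_iff.2 (Nat.lt_of_floor_lt hk))]
  · rw [SimpleFunc.coe_restrict _ (hball k)]
    exact Metric.isBounded_ball.subset support_indicator_subset

namespace IsPoissonPointProcess

variable {Ω : Type*} [MeasurableSpace Ω] {P : Measure Ω} {lam : ℝ}
  {x : ℕ → Ω → EuclideanSpace ℝ (Fin 2)} {A I : Set (EuclideanSpace ℝ (Fin 2))}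

theorem setLIntegral_negExp_sum_mul_pointCount (hx : IsPoissonPointProcess lam x P)
    (hA : MeasurableSet A) (hAbdd : Bornology.IsBounded A) (n : ℕ) {ι : Type*} [Fintype ι]
    {B : ι → Set (EuclideanSpace ℝ (Fin 2))} (hB : ∀ j, MeasurableSet (B j))
    (hBbdd : ∀ j, Bornology.IsBounded (B j)) (hdisj : Pairwise (Function.onFun Disjoint B))
    (hAB : ∀ j, Disjoint A (B j)) (c : ι → ℝ≥0∞) :
    ∫⁻ ω in {ω | pointCount (x · ω) A = n}, negExp (∑ j, c j * pointCount (x · ω) (B j)) ∂P =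
      poissonMeasure (lam * (volume A).toReal).toNNReal {n} *
        negExp (ENNReal.ofReal lam * ∑ j, (1 - negExp (c j)) * volume (B j)) := by
  let B' : Option ι → Set (EuclideanSpace ℝ (Fin 2)) := fun j => j.elim A B
  let F : Option ι → ℕ∞ → ℝ≥0∞ :=
    fun j => j.elim (fun k => if k = n then 1 else 0) fun j k => negExp (c j * k)
  have hdisj' : Pairwise (Function.onFun Disjoint B') := by
    rintro (_ | i) (_ | j) hij
    exacts [absurd rfl hij, hAB j, (hAB i).symm, hdisj fun h => hij (congrArg some h)]
  have hprod : ∀ ω, indicator {ω | pointCount (x · ω) A = n}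
      (fun ω => negExp (∑ j, c j * pointCount (x · ω) (B j))) ω =
      ∏ j, F j (pointCount (x · ω) (B' j)) := fun ω => by
    simp [Fintype.prod_option, negExp_sum, F, B', indicator]
  have hnone : ∀ r, ∫⁻ k : ℕ, F none k ∂poissonMeasure r = poissonMeasure r {n} := fun r => by
    rw [← lintegral_indicator_one (measurableSet_singleton n)]
    exact lintegral_congr fun k => by simp [F, indicator_apply]
  have hsome : ∀ j, ∫⁻ k : ℕ, F (some j) k ∂poissonMeasure (lam * (volume (B j)).toReal).toNNReal =
      negExp (ENNReal.ofReal lam * ((1 - negExp (c j)) * volume (B j))) := fun j => by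
    refine (lintegral_negExp_mul_poissonMeasure _ (c j)).trans ?_
    rw [coe_toNNReal_mul_toReal lam (hBbdd j).measure_lt_top.ne, mul_right_comm, mul_assoc]
  rw [← lintegral_indicator (measurableSet_pointCount_eq hx.measurable hA _)]
  simp_rw [hprod]
  rw [hx.lintegral_prod_comp_pointCount (Option.forall.2 ⟨hA, hB⟩) (Option.forall.2 ⟨hAbdd, hBbdd⟩)
    hdisj', Fintype.prod_option, hnone, Finset.mul_sum, negExp_sum]
  simp_rw [← hsome]
  rfl

theorem setLIntegral_negExp_tsum_simpleFunc (hx : IsPoissonPointProcess lam x P)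
    (hA : MeasurableSet A) (hAbdd : Bornology.IsBounded A) (n : ℕ)
    {f : SimpleFunc (EuclideanSpace ℝ (Fin 2)) ℝ≥0∞}
    (hf : Bornology.IsBounded (Function.support f)) (hfA : ∀ y ∈ A, f y = 0) :
    ∫⁻ ω in {ω | pointCount (x · ω) A = n}, negExp (∑' i, f (x i ω)) ∂P =
      poissonMeasure (lam * (volume A).toReal).toNNReal {n} *
        negExp (ENNReal.ofReal lam * ∫⁻ y, (1 - negExp (f y))) := by
  have hne : ∀ c : f.range.erase 0, c.1 ≠ 0 := fun c => (Finset.mem_erase.1 c.2).1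
  simp_rw [tsum_comp_eq_sum_mul_pointCount f, lintegral_one_sub_negExp_simpleFunc]
  exact hx.setLIntegral_negExp_sum_mul_pointCount (ι := f.range.erase 0) hA hAbdd n
    (fun c => f.measurableSet_fiber c)
    (fun c => hf.subset fun y hy => ne_of_eq_of_ne (by exact hy) (hne c))
    (fun c d hcd => Disjoint.preimage f (disjoint_singleton.2 (Subtype.val_injective.ne hcd)))
    (fun c => disjoint_left.2 fun y hyA hy => hne c (hy.symm.trans (hfA y hyA))) Subtype.val

theorem setLIntegral_negExp_tsum (hx : IsPoissonPointProcess lam x P)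
    (hA : MeasurableSet A) (hAbdd : Bornology.IsBounded A) (n : ℕ)
    {f : EuclideanSpace ℝ (Fin 2) → ℝ≥0∞} (hf : Measurable f) (hfA : ∀ y ∈ A, f y = 0) :
    ∫⁻ ω in {ω | pointCount (x · ω) A = n}, negExp (∑' i, f (x i ω)) ∂P =
      poissonMeasure (lam * (volume A).toReal).toNNReal {n} *
        negExp (ENNReal.ofReal lam * ∫⁻ y, (1 - negExp (f y))) := by
  have := hx.isProbabilityMeasure
  obtain ⟨φ, hmono, hlim, hbdd⟩ := exists_monotone_simpleFunc_tendsto hf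
  have hφA : ∀ k, ∀ y ∈ A, φ k y = 0 := fun k y hy => le_zero_iff.1 <|
    hfA y hy ▸ Monotone.ge_of_tendsto (fun k l hkl => hmono hkl y) (hlim y) k
  have hsum : ∀ ω, Tendsto (fun k => ∑' i, φ k (x i ω)) atTop (𝓝 (∑' i, f (x i ω))) := fun ω => by
    simp_rw [← lintegral_count]
    exact lintegral_tendsto_of_tendsto_of_monotone
      (fun k => (measurable_of_countable _).aemeasurable)
      (.of_forall fun i k l hkl => hmono hkl _) (.of_forall fun i => hlim _)
  have hleft := tendsto_lintegral_negExp (P := P.restrict {ω | pointCount (x · ω) A = n})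
    (fun k => .tsum fun i => (φ k).measurable.comp (hx.measurable i)) hsum
  have hloss : Tendsto (fun k => ∫⁻ y, (1 - negExp (φ k y))) atTop
      (𝓝 (∫⁻ y, (1 - negExp (f y)))) :=
    lintegral_tendsto_of_tendsto_of_monotone
      (fun k => (measurable_const.sub (measurable_negExp.comp (φ k).measurable)).aemeasurable)
      (.of_forall fun y k l hkl => tsub_le_tsub_left (antitone_negExp (hmono hkl y)) 1)
      (.of_forall fun y => ENNReal.Tendsto.sub tendsto_const_nhds
        ((continuous_negExp.tendsto _).comp (hlim y)) (Or.inl ENNReal.one_ne_top))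
  have hright := ENNReal.Tendsto.const_mul ((continuous_negExp.tendsto _).comp
    (ENNReal.Tendsto.const_mul hloss (Or.inr (ENNReal.ofReal_ne_top (r := lam)))))
    (Or.inr (measure_ne_top (poissonMeasure (lam * (volume A).toReal).toNNReal) {n}))
  refine tendsto_nhds_unique (hleft.congr fun k => ?_) hright
  exact hx.setLIntegral_negExp_tsum_simpleFunc hA hAbdd n (hbdd k) (hφA k)

theorem setLIntegral_negExp_tsum_of_void (hx : IsPoissonPointProcess lam x P)
    (hI : MeasurableSet I) (hA : MeasurableSet A) (hAbdd : Bornology.IsBounded A)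
    (hIA : Disjoint I A) (n : ℕ) {f : EuclideanSpace ℝ (Fin 2) → ℝ≥0∞} (hf : Measurable f)
    (hfI : ∀ y ∈ I, f y = 0) (hfA : ∀ y ∈ A, f y = 0) :
    ∫⁻ ω in {ω | pointCount (x · ω) I = 0 ∧ pointCount (x · ω) A = n},
        negExp (∑' i, f (x i ω)) ∂P =
      poissonMeasure (lam * (volume A).toReal).toNNReal {n} *
        negExp (ENNReal.ofReal lam * (volume I + ∫⁻ y, (1 - negExp (f y)))) := by
  let fI : EuclideanSpace ℝ (Fin 2) → ℝ≥0∞ := fun y => f y + I.indicator (fun _ => ∞) y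
  have hmeas : Measurable fI := hf.add (measurable_const.indicator hI)
  have hvoid : ∀ ω, indicator {ω | pointCount (x · ω) I = 0}
      (fun ω => negExp (∑' i, f (x i ω))) ω =
      negExp (∑' i, fI (x i ω)) := fun ω => by
    by_cases hω : pointCount (x · ω) I = 0
    · rw [indicator_of_mem (by exact hω)]
      have hω' := pointCount_eq_zero_iff.1 hω
      simp only [fI, indicator_of_notMem (hω' _), add_zero]
    · rw [indicator_of_notMem (by exact hω)]
      rw [pointCount_eq_zero_iff] at hω
      push Not at hω
      obtain ⟨i, hi⟩ := hω
      have hi_top : fI (x i ω) = ∞ := by simp [fI, hi]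
      rw [ENNReal.tsum_eq_top_of_eq_top ⟨i, hi_top⟩, negExp_top]
  have hloss : ∫⁻ y, (1 - negExp (fI y)) = volume I + ∫⁻ y, (1 - negExp (f y)) := by
    rw [← lintegral_indicator_one hI, ← lintegral_add_left (measurable_one.indicator hI)]
    refine lintegral_congr fun y => ?_
    by_cases hy : y ∈ I <;> simp [fI, hy, hfI]
  have hfIA : ∀ y ∈ A, fI y = 0 := fun y hy => by
    simp [fI, hfA y hy, hIA.notMem_of_mem_right hy]
  rw [← hloss, ← hx.setLIntegral_negExp_tsum hA hAbdd n hmeas hfIA]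
  simp_rw [← hvoid]
  rw [setLIntegral_indicator (measurableSet_pointCount_eq hx.measurable hI _)]
  rfl

end IsPoissonPointProcess

end LaplaceFunctional

section RadialIntegration

theorem volume_preimage_norm_sq_Iio (b : ℝ) :
    volume ((fun y : EuclideanSpace ℝ (Fin 2) => ‖y‖ ^ 2) ⁻¹' Iio b) =
      ENNReal.ofReal Real.pi * ENNReal.ofReal b := by
  have hball : (fun y : EuclideanSpace ℝ (Fin 2) => ‖y‖ ^ 2) ⁻¹' Iio b = Metric.ball 0 (√b) := by
    ext y
    rw [mem_ball_zero_iff, Real.lt_sqrt (norm_nonneg y)]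
    rfl
  rw [hball, EuclideanSpace.volume_ball_fin_two, ← ENNReal.ofReal_pow (Real.sqrt_nonneg b),
    Real.sq_sqrt', ENNReal.ofReal_max]
  simp [mul_comm]

theorem map_norm_sq_volume :
    (volume : Measure (EuclideanSpace ℝ (Fin 2))).map (fun y => ‖y‖ ^ 2) =
      ENNReal.ofReal Real.pi • volume.restrict (Ici 0) := by
  have hnorm : Measurable fun y : EuclideanSpace ℝ (Fin 2) => ‖y‖ ^ 2 := by fun_prop
  have hIco (a b : ℝ) (hab : a < b) :
      (volume : Measure (EuclideanSpace ℝ (Fin 2))).map (fun y => ‖y‖ ^ 2) (Ico a b) =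
        ENNReal.ofReal Real.pi * (ENNReal.ofReal b - ENNReal.ofReal a) := by
    rw [Measure.map_apply hnorm measurableSet_Ico, ← Iio_sdiff_Iio, preimage_sdiff,
      measure_sdiff (preimage_mono (Iio_subset_Iio hab.le))
        (hnorm measurableSet_Iio).nullMeasurableSet
        (by simp [volume_preimage_norm_sq_Iio, ENNReal.mul_eq_top]),
      volume_preimage_norm_sq_Iio, volume_preimage_norm_sq_Iio,
      ENNReal.mul_sub fun _ _ => ENNReal.ofReal_ne_top]
  refine Measure.ext_of_Ico' _ _ (fun a b hab => ?_) fun a b hab => ?_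
  · rw [hIco a b hab]
    exact ENNReal.mul_ne_top ENNReal.ofReal_ne_top (by simp)
  · rw [hIco a b hab, Measure.smul_apply, Measure.restrict_apply measurableSet_Ico, smul_eq_mul,
      inter_comm, ← Ici_inter_Iio, ← inter_assoc, Ici_inter_Ici, Ici_inter_Iio, Real.volume_Ico,
      ENNReal.ofReal_sub _ (le_max_left 0 a), ENNReal.ofReal_max, ENNReal.ofReal_zero,
      max_eq_right zero_le]

theorem setLIntegral_Ici_comp_norm_sq {F : ℝ → ℝ≥0∞} (hF : Measurable F) {t : ℝ} (ht : 0 ≤ t) :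
    ∫⁻ y in {y : EuclideanSpace ℝ (Fin 2) | t ≤ ‖y‖ ^ 2}, F (‖y‖ ^ 2) =
      ENNReal.ofReal Real.pi * ∫⁻ v in Ici t, F v := by
  have hnorm : Measurable fun y : EuclideanSpace ℝ (Fin 2) => ‖y‖ ^ 2 := by fun_prop
  have h := setLIntegral_map (μ := volume) measurableSet_Ici hF hnorm (s := Ici t)
  rw [map_norm_sq_volume, Measure.restrict_smul, Measure.restrict_restrict measurableSet_Ici,
    lintegral_smul_measure, inter_eq_left.2 (Ici_subset_Ici.2 ht)] at h
  exact h.symm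

theorem setLIntegral_Ici_comp_add_div {F : ℝ → ℝ≥0∞} (hF : Measurable F) (c t : ℝ) {m : ℝ}
    (hm : 0 < m) :
    ∫⁻ v in Ici t, F ((v + c) / m) = ENNReal.ofReal m * ∫⁻ u in Ici ((t + c) / m), F u := by
  have hmap : (volume : Measure ℝ).map (fun v => (v + c) / m) = ENNReal.ofReal m • volume := by
    have hcomp : (fun v : ℝ => (v + c) / m) = (fun v => v * m⁻¹) ∘ fun v => v + c := by
      ext v
      exact div_eq_mul_inv _ _
    rw [hcomp, ← Measure.map_map (by fun_prop) (by fun_prop), map_add_right_eq_self,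
      Real.map_volume_mul_right (inv_ne_zero hm.ne'), inv_inv, abs_of_pos hm]
  have hpre : (fun v => (v + c) / m) ⁻¹' Ici ((t + c) / m) = Ici t := by
    ext v
    simp [div_le_div_iff_of_pos_right hm]
  rw [← hpre, ← setLIntegral_map measurableSet_Ici hF (by fun_prop), hmap, Measure.restrict_smul,
    lintegral_smul_measure, smul_eq_mul]

/-- The half-open annulus `s ≤ ‖y‖ ^ 2 < t` around the origin, parametrised by squared radii so
that its area is proportional to `t - s`. -/
def sqAnnulus (s t : ℝ) : Set (EuclideanSpace ℝ (Fin 2)) := {y | ‖y‖ ^ 2 ∈ Ico s t}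

theorem measurableSet_sqAnnulus (s t : ℝ) : MeasurableSet (sqAnnulus s t) :=
  (by fun_prop : Measurable fun y : EuclideanSpace ℝ (Fin 2) => ‖y‖ ^ 2) measurableSet_Ico

theorem isBounded_sqAnnulus (s t : ℝ) : Bornology.IsBounded (sqAnnulus s t) := by
  refine (Metric.isBounded_ball (x := 0) (r := √t)).subset fun y hy => ?_
  rw [mem_ball_zero_iff, Real.lt_sqrt (norm_nonneg y)]
  exact hy.2

theorem volume_sqAnnulus {s : ℝ} (hs : 0 ≤ s) (t : ℝ) :
    volume (sqAnnulus s t) = ENNReal.ofReal (Real.pi * (t - s)) := by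
  have hnorm : Measurable fun y : EuclideanSpace ℝ (Fin 2) => ‖y‖ ^ 2 := by fun_prop
  have h := Measure.map_apply (μ := volume) hnorm (measurableSet_Ico (a := s) (b := t))
  rw [map_norm_sq_volume, Measure.smul_apply, Measure.restrict_apply measurableSet_Ico,
    inter_eq_left.2 (Ico_subset_Ici_self.trans (Ici_subset_Ici.2 hs)), Real.volume_Ico, smul_eq_mul,
    ← ENNReal.ofReal_mul Real.pi_nonneg] at h
  exact h.symm

end RadialIntegration

section NearestPoint

variable {Ω : Type*} [MeasurableSpace Ω] {P : Measure Ω} {lam s t : ℝ}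
  {x : ℕ → Ω → EuclideanSpace ℝ (Fin 2)}

/-- The configuration `y` has exactly one point in the annulus `sqAnnulus s t` and none inside it,
so that this point is the closest one to the origin. -/
def HasIsolatedNearest (s t : ℝ) (y : ℕ → EuclideanSpace ℝ (Fin 2)) : Prop :=
  pointCount y (sqAnnulus 0 s) = 0 ∧ pointCount y (sqAnnulus s t) = 1

theorem HasIsolatedNearest.exists_index {y : ℕ → EuclideanSpace ℝ (Fin 2)}
    (hy : HasIsolatedNearest s t y) :
    ∃ i, ‖y i‖ ^ 2 ∈ Ico s t ∧ ∀ j ≠ i, t ≤ ‖y j‖ ^ 2 := by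
  obtain ⟨i, hi⟩ := Set.encard_eq_one.1 hy.2
  have hmem (j : ℕ) : ‖y j‖ ^ 2 ∈ Ico s t ↔ j = i := Set.ext_iff.1 hi j
  refine ⟨i, (hmem i).2 rfl, fun j hj => ?_⟩
  have hs : s ≤ ‖y j‖ ^ 2 := not_lt.1 fun h => pointCount_eq_zero_iff.1 hy.1 j ⟨sq_nonneg _, h⟩
  exact not_lt.1 fun h => hj ((hmem j).1 ⟨hs, h⟩)

theorem measurableSet_hasIsolatedNearest (hx : ∀ i, Measurable (x i)) (s t : ℝ) :
    MeasurableSet {ω | HasIsolatedNearest s t (x · ω)} :=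
  (measurableSet_pointCount_eq hx (measurableSet_sqAnnulus 0 s) 0).inter
    (measurableSet_pointCount_eq hx (measurableSet_sqAnnulus s t) 1)

theorem not_hasIsolatedNearest_of_le {s' t' : ℝ} (hts : t ≤ s') (hs : 0 ≤ s)
    {y : ℕ → EuclideanSpace ℝ (Fin 2)} (hy : HasIsolatedNearest s t y) :
    ¬ HasIsolatedNearest s' t' y := fun hy' => by
  obtain ⟨i, hi, -⟩ := hy.exists_index
  exact pointCount_eq_zero_iff.1 hy'.1 i ⟨hs.trans hi.1, hi.2.trans_le hts⟩

theorem poissonMeasure_singleton_one {r : ℝ} (hr : 0 ≤ r) :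
    poissonMeasure r.toNNReal {1} = ENNReal.ofReal r * negExp (ENNReal.ofReal r) := by
  rw [negExp_ofReal hr, poissonMeasure_singleton, ← ENNReal.ofReal_mul hr, Real.coe_toNNReal r hr]
  simp [mul_comm]

theorem IsPoissonPointProcess.setLIntegral_hasIsolatedNearest
    (hx : IsPoissonPointProcess lam x P) (hlam : 0 ≤ lam) (hs : 0 ≤ s) (hst : s ≤ t)
    {F : ℝ → ℝ≥0∞} (hF : Measurable F) :
    ∫⁻ ω in {ω | HasIsolatedNearest s t (x · ω)},
        negExp (∑' i, (Ici t).indicator F (‖x i ω‖ ^ 2)) ∂P =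
      ENNReal.ofReal (lam * Real.pi * (t - s)) *
        negExp (ENNReal.ofReal (lam * Real.pi) *
          (ENNReal.ofReal t + ∫⁻ v in Ici t, (1 - negExp (F v)))) := by
  have hdisj : Disjoint (sqAnnulus 0 s) (sqAnnulus s t) :=
    disjoint_left.2 fun y h₀ h₁ => h₁.1.not_gt h₀.2
  have hloss : ∫⁻ y : EuclideanSpace ℝ (Fin 2), (1 - negExp ((Ici t).indicator F (‖y‖ ^ 2))) =
      ENNReal.ofReal Real.pi * ∫⁻ v in Ici t, (1 - negExp (F v)) := by
    rw [← setLIntegral_Ici_comp_norm_sq (F := fun v => 1 - negExp (F v))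
      (measurable_const.sub (measurable_negExp.comp hF)) (hs.trans hst),
      ← lintegral_indicator (measurableSet_le (by fun_prop) (by fun_prop))]
    refine lintegral_congr fun y => ?_
    by_cases hy : t ≤ ‖y‖ ^ 2 <;> simp [hy]
  have h := hx.setLIntegral_negExp_tsum_of_void (measurableSet_sqAnnulus 0 s)
    (measurableSet_sqAnnulus s t) (isBounded_sqAnnulus s t) hdisj 1
    (f := fun y => (Ici t).indicator F (‖y‖ ^ 2))
    ((hF.indicator measurableSet_Ici).comp (by fun_prop))
    (fun y hy => indicator_of_notMem (not_le.2 (hy.2.trans_le hst)) _)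
    (fun y hy => indicator_of_notMem (not_le.2 hy.2) _)
  rw [hloss] at h
  have hexponent (I : ℝ≥0∞) : ENNReal.ofReal (lam * Real.pi * (t - s)) +
      ENNReal.ofReal lam * (ENNReal.ofReal (Real.pi * (s - 0)) + ENNReal.ofReal Real.pi * I) =
        ENNReal.ofReal (lam * Real.pi) * (ENNReal.ofReal t + I) := by
    rw [← add_sub_cancel s t, ENNReal.ofReal_add hs (sub_nonneg.2 hst), sub_zero,
      add_sub_cancel_left, ENNReal.ofReal_mul (mul_nonneg hlam Real.pi_nonneg),
      ENNReal.ofReal_mul hlam, ENNReal.ofReal_mul Real.pi_nonneg]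
    ring
  rw [volume_sqAnnulus hs, volume_sqAnnulus le_rfl,
    ENNReal.toReal_ofReal (mul_nonneg Real.pi_nonneg (sub_nonneg.2 hst)), ← mul_assoc,
    poissonMeasure_singleton_one
      (mul_nonneg (mul_nonneg hlam Real.pi_nonneg) (sub_nonneg.2 hst)),
    mul_assoc, ← negExp_add, hexponent] at h
  exact h

theorem IsPoissonPointProcess.measure_hasIsolatedNearest
    (hx : IsPoissonPointProcess lam x P) (hlam : 0 ≤ lam) (hs : 0 ≤ s) (hst : s ≤ t) :
    P {ω | HasIsolatedNearest s t (x · ω)} =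
      ENNReal.ofReal (lam * Real.pi * (t - s) * Real.exp (-(lam * Real.pi * t))) := by
  have h := hx.setLIntegral_hasIsolatedNearest hlam hs hst (F := fun _ => 0) measurable_const
  simp only [indicator_zero, tsum_zero, negExp_zero, setLIntegral_one, tsub_self, lintegral_zero,
    add_zero] at h
  rw [h, ← ENNReal.ofReal_mul (by positivity), negExp_ofReal
    (mul_nonneg (by positivity) (hs.trans hst)), ← ENNReal.ofReal_mul
    (mul_nonneg (by positivity) (sub_nonneg.2 hst))]

end NearestPoint

section InterferenceExponent

variable {b θ : ℝ}

/-- The exponent which an interfering base station contributes to the coverage probability under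
Rayleigh fading, when `u` is the ratio of its value of `r ^ 2 + h ^ 2` to that of the serving base
station and `b` is half the path loss exponent. -/
def interferenceExponent (b θ u : ℝ) : ℝ≥0∞ := ENNReal.ofReal (Real.log (1 + θ * u ^ (-b)))

theorem measurable_interferenceExponent (b θ : ℝ) : Measurable (interferenceExponent b θ) := by
  unfold interferenceExponent
  fun_prop

theorem antitoneOn_interferenceExponent (hb : 0 ≤ b) (hθ : 0 ≤ θ) :
    AntitoneOn (interferenceExponent b θ) (Ioi 0) := fun u hu v hv huv => by
  have hle : v ^ (-b) ≤ u ^ (-b) := Real.rpow_le_rpow_of_nonpos hu huv (neg_nonpos.2 hb)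
  have hpos : 0 ≤ v ^ (-b) := Real.rpow_nonneg (mem_Ioi.1 hv).le _
  exact ENNReal.ofReal_le_ofReal (Real.log_le_log (by positivity) (by gcongr))

theorem one_sub_negExp_interferenceExponent (hθ : 0 ≤ θ) {u : ℝ} (hu : 0 ≤ u) :
    1 - negExp (interferenceExponent b θ u) = ENNReal.ofReal (interferenceKernel b θ u) := by
  have hw : 0 ≤ θ * u ^ (-b) := mul_nonneg hθ (Real.rpow_nonneg hu _)
  rw [interferenceExponent, negExp_ofReal (Real.log_nonneg (by linarith)), Real.exp_neg,
    Real.exp_log (by linarith), ← ENNReal.ofReal_one, ← ENNReal.ofReal_sub _ (by positivity),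
    interferenceKernel]
  congr 1
  field_simp
  ring

theorem setLIntegral_Ici_one_sub_negExp_interferenceExponent (hb : 1 < b) (hθ : 0 ≤ θ)
    {c t m : ℝ} (htc : 0 < t + c) (hm : 0 < m) :
    ∫⁻ v in Ici t, (1 - negExp (interferenceExponent b θ ((v + c) / m))) =
      ENNReal.ofReal (m * ∫ u in Ioi ((t + c) / m), interferenceKernel b θ u) := by
  have hρ : 0 < (t + c) / m := by positivity
  rw [setLIntegral_Ici_comp_add_div (F := fun u => 1 - negExp (interferenceExponent b θ u))
      (measurable_const.sub (measurable_negExp.comp (measurable_interferenceExponent b θ))) c t hm,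
    setLIntegral_congr Ioi_ae_eq_Ici.symm, ENNReal.ofReal_mul hm.le,
    ofReal_integral_eq_lintegral_ofReal (integrableOn_interferenceKernel hb hθ hρ)
      (ae_restrict_of_forall_mem measurableSet_Ioi fun u hu =>
        interferenceKernel_nonneg hθ (hρ.trans hu).le)]
  congr 1
  exact setLIntegral_congr_fun measurableSet_Ioi fun u hu =>
    one_sub_negExp_interferenceExponent hθ (hρ.trans hu).le

/-- The total interference exponent of the base stations of the configuration `y` at squared
distance at least `t`, when `c` is the squared height and `m` is the value of `r ^ 2 + c` for the
serving base station. -/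
def outerExponent (b θ c t m : ℝ) (y : ℕ → EuclideanSpace ℝ (Fin 2)) : ℝ≥0∞ :=
  ∑' i, (Ici t).indicator (fun v => interferenceExponent b θ ((v + c) / m)) (‖y i‖ ^ 2)

theorem IsPoissonPointProcess.setLIntegral_negExp_outerExponent {Ω : Type*} [MeasurableSpace Ω]
    {P : Measure Ω} {x : ℕ → Ω → EuclideanSpace ℝ (Fin 2)} {lam c s t m : ℝ}
    (hx : IsPoissonPointProcess lam x P) (hlam : 0 ≤ lam) (hb : 1 < b) (hθ : 0 ≤ θ) (hc : 0 < c)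
    (hs : 0 ≤ s) (hst : s ≤ t) (hm : 0 < m) :
    ∫⁻ ω in {ω | HasIsolatedNearest s t (x · ω)}, negExp (outerExponent b θ c t m (x · ω)) ∂P =
      ENNReal.ofReal ((t - s) * (lam * Real.pi * Real.exp (-(lam * Real.pi *
        (t + m * ∫ u in Ioi ((t + c) / m), interferenceKernel b θ u))))) := by
  have ht : 0 ≤ t := hs.trans hst
  have hmeas : Measurable fun v => interferenceExponent b θ ((v + c) / m) :=
    (measurable_interferenceExponent b θ).comp (by fun_prop)
  have hI : 0 ≤ m * ∫ u in Ioi ((t + c) / m), interferenceKernel b θ u :=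
    mul_nonneg hm.le (setIntegral_nonneg measurableSet_Ioi fun u hu =>
      interferenceKernel_nonneg hθ ((by positivity : 0 ≤ (t + c) / m).trans (mem_Ioi.1 hu).le))
  simp only [outerExponent]
  rw [hx.setLIntegral_hasIsolatedNearest hlam hs hst hmeas,
    setLIntegral_Ici_one_sub_negExp_interferenceExponent hb hθ (by positivity) hm,
    ← ENNReal.ofReal_add ht hI, ← ENNReal.ofReal_mul (by positivity),
    negExp_ofReal (by positivity), ← ENNReal.ofReal_mul
      (mul_nonneg (by positivity) (sub_nonneg.2 hst))]
  congr 1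
  ring

/-- The density, with respect to the squared distance `u` of the closest base station, of the event
that it covers the origin; `c` is the squared height of the base stations and `K` is the integral
of the interference kernel over `(1, ∞)`. -/
def coverageDensity (lam K c u : ℝ) : ℝ :=
  lam * Real.pi * Real.exp (-(lam * Real.pi * (u + (u + c) * K)))

end InterferenceExponent

section Coverage

variable {Ω : Type*} {α h θ lam s t : ℝ} {x : ℕ → Ω → EuclideanSpace ℝ (Fin 2)}
  {g : ℕ → Ω → ℝ}

theorem pathloss_pos (hh : 0 < h) (r : ℝ) : 0 < pathloss α h r := by
  unfold pathloss
  positivity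

theorem pathloss_div_pathloss (hh : 0 < h) (r s : ℝ) :
    pathloss α h s / pathloss α h r = ((s ^ 2 + h ^ 2) / (r ^ 2 + h ^ 2)) ^ (-(α / 2)) := by
  unfold pathloss
  rw [Real.div_rpow (by positivity) (by positivity)]

theorem ofReal_lt_sir_iff (hh : 0 < h) (hθ : 0 < θ) (i : ℕ) (ω : Ω) :
    ENNReal.ofReal θ < sir α h x g i ω ↔
      ∑' j : {j // j ≠ i}, ENNReal.ofReal
        (θ * (pathloss α h ‖x j ω‖ / pathloss α h ‖x i ω‖) * g j ω) < ENNReal.ofReal (g i ω) := by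
  have hl := pathloss_pos (α := α) hh ‖x i ω‖
  have hterm (j : {j // j ≠ i}) :
      ENNReal.ofReal θ * ENNReal.ofReal (g j ω * pathloss α h ‖x j ω‖) =
        ENNReal.ofReal (pathloss α h ‖x i ω‖) * ENNReal.ofReal
          (θ * (pathloss α h ‖x j ω‖ / pathloss α h ‖x i ω‖) * g j ω) := by
    rw [← ENNReal.ofReal_mul hθ.le, ← ENNReal.ofReal_mul hl.le]
    congr 1
    field_simp
  rw [sir, ENNReal.lt_div_iff_mul_lt (Or.inr ENNReal.ofReal_ne_top)
    (Or.inr (ENNReal.ofReal_pos.2 hθ).ne'), ← ENNReal.tsum_mul_left, tsum_congr hterm,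
    ENNReal.tsum_mul_left, mul_comm (g i ω), ENNReal.ofReal_mul hl.le,
    ENNReal.mul_lt_mul_iff_right (ENNReal.ofReal_pos.2 hl).ne' ENNReal.ofReal_ne_top]

/-- The event that the closest base station covers the origin, when the base stations have the
deterministic locations `y`. -/
def coverageEvent (α h θ : ℝ) (y : ℕ → EuclideanSpace ℝ (Fin 2)) (g : ℕ → Ω → ℝ) : Set Ω :=
  {ω | ∃ i, (∀ j, ‖y i‖ ≤ ‖y j‖) ∧ ENNReal.ofReal θ < sir α h (fun i _ => y i) g i ω}

theorem measurableSet_coverage (α h θ : ℝ) :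
    MeasurableSet {p : (ℕ → EuclideanSpace ℝ (Fin 2)) × (ℕ → ℝ) |
      p.2 ∈ coverageEvent α h θ p.1 fun i w => w i} := by
  have hy (i : ℕ) : Measurable fun p : (ℕ → EuclideanSpace ℝ (Fin 2)) × (ℕ → ℝ) => p.1 i := by
    fun_prop
  have hpower (i : ℕ) : Measurable fun p : (ℕ → EuclideanSpace ℝ (Fin 2)) × (ℕ → ℝ) =>
      ENNReal.ofReal (p.2 i * pathloss α h ‖p.1 i‖) := by
    unfold pathloss
    fun_prop
  simp only [coverageEvent, mem_ofPred_eq]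
  simp only [ofPred_exists, ofPred_and, ofPred_forall]
  refine .iUnion fun i => .inter (.iInter fun j => measurableSet_le (hy i).norm (hy j).norm) ?_
  exact measurableSet_lt measurable_const ((hpower i).div (Measurable.tsum fun j => hpower j))

variable [MeasurableSpace Ω] {P : Measure Ω}

theorem measure_coverageEvent_of_forall_lt (hh : 0 < h) (hθ : 0 < θ) (hg : ∀ i, Measurable (g i))
    (hlaw : ∀ i, P.map (g i) = expMeasure 1) (hind : iIndepFun g P)
    {y : ℕ → EuclideanSpace ℝ (Fin 2)} {i : ℕ} (hi : ∀ j ≠ i, ‖y i‖ < ‖y j‖) :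
    P (coverageEvent α h θ y g) = negExp (∑' j : {j // j ≠ i},
      interferenceExponent (α / 2) θ ((‖y j‖ ^ 2 + h ^ 2) / (‖y i‖ ^ 2 + h ^ 2))) := by
  have hnearest (i' : ℕ) : (∀ j, ‖y i'‖ ≤ ‖y j‖) ↔ i' = i := by
    refine ⟨fun h => by_contra fun hne => (hi i' hne).not_ge (h i), ?_⟩
    rintro rfl j
    exact (eq_or_ne j i').elim (fun hj => hj ▸ le_rfl) fun hj => (hi j hj).le
  have hevent : coverageEvent α h θ y g = {ω | ∑' j : {j // j ≠ i}, ENNReal.ofReal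
      (θ * (pathloss α h ‖y j‖ / pathloss α h ‖y i‖) * g j ω) < ENNReal.ofReal (g i ω)} := by
    simp only [coverageEvent, hnearest, exists_eq_left, ofReal_lt_sir_iff hh hθ]
  rw [hevent, measure_tsum_ofReal_mul_lt_ofReal hg hlaw hind
    (w := fun j => θ * (pathloss α h ‖y j‖ / pathloss α h ‖y i‖))
    (fun j => mul_nonneg hθ.le (div_pos (pathloss_pos hh _) (pathloss_pos hh _)).le) i]
  simp only [pathloss_div_pathloss hh, interferenceExponent]

theorem HasIsolatedNearest.measure_coverageEvent_mem_Icc (hα : 0 ≤ α) (hh : 0 < h) (hθ : 0 < θ)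
    (hg : ∀ i, Measurable (g i)) (hlaw : ∀ i, P.map (g i) = expMeasure 1) (hind : iIndepFun g P)
    (hs : 0 ≤ s) {y : ℕ → EuclideanSpace ℝ (Fin 2)} (hy : HasIsolatedNearest s t y) :
    P (coverageEvent α h θ y g) ∈
      Icc (negExp (outerExponent (α / 2) θ (h ^ 2) t (t + h ^ 2) y))
        (negExp (outerExponent (α / 2) θ (h ^ 2) t (s + h ^ 2) y)) := by
  obtain ⟨i, hi, hj⟩ := hy.exists_index
  have hpos : 0 < s + h ^ 2 := by positivity
  have houter (m : ℝ) : outerExponent (α / 2) θ (h ^ 2) t m y =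
      ∑' j : {j // j ≠ i}, interferenceExponent (α / 2) θ ((‖y j‖ ^ 2 + h ^ 2) / m) := by
    rw [outerExponent, ← tsum_subtype_eq_of_support_subset (s := {j | j ≠ i})]
    · exact tsum_congr fun j => indicator_of_mem (hj j j.2) _
    · rintro j hne rfl
      exact hne (indicator_of_notMem (not_le.2 hi.2) _)
  have hanti {u v : ℝ} (hu : 0 < u) (huv : u ≤ v) (j : ℕ) :
      interferenceExponent (α / 2) θ ((‖y j‖ ^ 2 + h ^ 2) / u) ≤
        interferenceExponent (α / 2) θ ((‖y j‖ ^ 2 + h ^ 2) / v) :=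
    antitoneOn_interferenceExponent (by positivity) hθ.le
      (mem_Ioi.2 (div_pos (by positivity) (hu.trans_le huv))) (mem_Ioi.2 (by positivity))
      (by gcongr)
  rw [measure_coverageEvent_of_forall_lt hh hθ hg hlaw hind fun j hne =>
    lt_of_pow_lt_pow_left₀ 2 (norm_nonneg _) (hi.2.trans_le (hj j hne)), houter, houter]
  constructor <;> refine antitone_negExp (ENNReal.tsum_le_tsum fun j => ?_)
  · exact hanti (by positivity) (by linarith [hi.2]) j
  · exact hanti hpos (by linarith [hi.1]) j

namespace IsRayleighNetwork

theorem measure_coverage_eq_lintegral (hN : IsRayleighNetwork lam x g P) (α h θ : ℝ) :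
    P {ω | ∃ i, (∀ j, ‖x i ω‖ ≤ ‖x j ω‖) ∧ ENNReal.ofReal θ < sir α h x g i ω} =
      ∫⁻ ω, P (coverageEvent α h θ (x · ω) g) ∂P := by
  have := hN.poisson.isProbabilityMeasure
  have hX : Measurable fun ω i => x i ω := measurable_pi_lambda _ hN.poisson.measurable
  have hG : Measurable fun ω i => g i ω := measurable_pi_lambda _ hN.measurable_gain
  have hS := measurableSet_coverage α h θ
  have hprod := DFunLike.congr_fun
    (hN.indep.map_prod_eq_prod_map_map hX.aemeasurable hG.aemeasurable)
    {p | p.2 ∈ coverageEvent α h θ p.1 fun i w => w i}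
  rw [Measure.map_apply (hX.prodMk hG) hS, Measure.prod_apply hS,
    lintegral_map (measurable_measure_prodMk_left hS) hX] at hprod
  refine hprod.trans (lintegral_congr fun ω => ?_)
  exact Measure.map_apply hG (measurable_prodMk_left hS)

theorem setLIntegral_coverageEvent_mem_Icc (hN : IsRayleighNetwork lam x g P) (hlam : 0 ≤ lam)
    (hα : 2 < α) (hh : 0 < h) (hθ : 0 < θ) (hs : 0 ≤ s) (hst : s ≤ t) {K : ℝ}
    (hK : K = ∫ u in Ioi 1, interferenceKernel (α / 2) θ u) :
    ∫⁻ ω in {ω | HasIsolatedNearest s t (x · ω)}, P (coverageEvent α h θ (x · ω) g) ∂P ∈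
      Icc (ENNReal.ofReal ((t - s) * coverageDensity lam K (h ^ 2) t))
        (ENNReal.ofReal ((t - s) * coverageDensity lam K (h ^ 2) s)) := by
  have hb : 1 < α / 2 := by linarith
  have ht : 0 < t + h ^ 2 := by linarith [pow_pos hh 2]
  have hmeas := measurableSet_hasIsolatedNearest hN.poisson.measurable s t
  have hbounds (ω) (hω : HasIsolatedNearest s t (x · ω)) :=
    hω.measure_coverageEvent_mem_Icc (by linarith) hh hθ hN.measurable_gain hN.gain_law
      hN.gain_indep hs (α := α)
  have houter {m : ℝ} (hm : 0 < m) := hN.poisson.setLIntegral_negExp_outerExponent hlam hb hθ.le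
    (pow_pos hh 2) hs hst hm
  refine ⟨le_trans (le_of_eq ?_) (setLIntegral_mono' hmeas fun ω hω => (hbounds ω hω).1),
    (setLIntegral_mono' hmeas fun ω hω => (hbounds ω hω).2).trans ?_⟩
  · rw [houter ht, div_self ht.ne', ← hK, coverageDensity]
  · rw [houter (by positivity), coverageDensity]
    have hm : 0 < s + h ^ 2 := by positivity
    have hI := integral_interferenceKernel_sub_le hb hθ.le (ρ := (t + h ^ 2) / (s + h ^ 2))
      ((one_le_div hm).2 (by linarith))
    have hmass : s + (s + h ^ 2) * K ≤ t + (s + h ^ 2) *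
        ∫ u in Ioi ((t + h ^ 2) / (s + h ^ 2)), interferenceKernel (α / 2) θ u := by
      rw [← hK] at hI
      have := mul_le_mul_of_nonneg_left hI hm.le
      field_simp at this
      linarith
    have := sub_nonneg.2 hst
    gcongr

end IsRayleighNetwork

end Coverage

section RingDecomposition

theorem tsum_ofReal_mul_exp_neg_mul {a r : ℝ} (ha : 0 ≤ a) (hr : 0 < r) :
    ∑' k : ℕ, ENNReal.ofReal (a * Real.exp (-(r * k))) =
      ENNReal.ofReal (a / (1 - Real.exp (-r))) := by
  have hgeom := (hasSum_geometric_of_lt_one (Real.exp_pos (-r)).le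
    (Real.exp_lt_one_iff.2 (neg_lt_zero.2 hr))).mul_left a
  have hpow (k : ℕ) : Real.exp (-(r * k)) = Real.exp (-r) ^ k := by
    rw [← Real.exp_nat_mul]
    ring_nf
  simp_rw [hpow]
  rw [← ENNReal.ofReal_tsum_of_nonneg (fun k => by positivity) hgeom.summable, hgeom.tsum_eq,
    div_eq_mul_inv]

theorem ofReal_mul_sub_le_tsum_exp {a c ε : ℝ} (ha : 0 ≤ a) (hc : 0 < c) (hε : 0 < ε) :
    ENNReal.ofReal (a * (1 / c - ε)) ≤
      ∑' k : ℕ, ENNReal.ofReal (ε * (a * Real.exp (-(c * ((k + 1) * ε))))) := by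
  have hq : Real.exp (-(c * ε)) < 1 := Real.exp_lt_one_iff.2 (by linarith [mul_pos hc hε])
  have hterm (k : ℕ) : ε * (a * Real.exp (-(c * ((k + 1) * ε)))) =
      a * (ε * Real.exp (-(c * ε))) * Real.exp (-(c * ε * k)) := by
    rw [mul_assoc a, mul_assoc ε, ← Real.exp_add]
    ring_nf
  simp_rw [hterm]
  rw [tsum_ofReal_mul_exp_neg_mul (by positivity) (mul_pos hc hε), mul_div_assoc]
  refine ENNReal.ofReal_le_ofReal (mul_le_mul_of_nonneg_left ?_ ha)
  rw [le_div_iff₀ (by linarith)]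
  have hexp : 1 / c * (1 - Real.exp (-(c * ε))) ≤ 1 / c * (c * ε) := by
    gcongr
    linarith [Real.add_one_le_exp (-(c * ε))]
  rw [← mul_assoc, one_div_mul_cancel hc.ne', one_mul] at hexp
  linarith

theorem tsum_exp_le_ofReal_mul_add {a c ε : ℝ} (ha : 0 ≤ a) (hc : 0 < c) (hε : 0 < ε) :
    ∑' k : ℕ, ENNReal.ofReal (ε * (a * Real.exp (-(c * (k * ε))))) ≤
      ENNReal.ofReal (a * (1 / c + ε)) := by
  have hq : Real.exp (-(c * ε)) < 1 := Real.exp_lt_one_iff.2 (by linarith [mul_pos hc hε])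
  have hterm (k : ℕ) : ε * (a * Real.exp (-(c * (k * ε)))) =
      a * ε * Real.exp (-(c * ε * k)) := by
    ring_nf
  simp_rw [hterm]
  rw [tsum_ofReal_mul_exp_neg_mul (by positivity) (mul_pos hc hε), mul_div_assoc]
  refine ENNReal.ofReal_le_ofReal (mul_le_mul_of_nonneg_left ?_ ha)
  rw [div_le_iff₀ (by linarith)]
  have hexp : Real.exp (-(c * ε)) * (1 + c * ε) ≤ Real.exp (-(c * ε)) * Real.exp (c * ε) := by
    gcongr
    linarith [Real.add_one_le_exp (c * ε)]
  rw [← Real.exp_add, neg_add_cancel, Real.exp_zero] at hexp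
  have := mul_le_mul_of_nonneg_left hexp (one_div_pos.2 hc).le
  field_simp at this ⊢
  linarith

theorem coverageDensity_eq_mul_exp (lam K c u : ℝ) :
    coverageDensity lam K c u =
      coverageDensity lam K c 0 * Real.exp (-(lam * Real.pi * (1 + K) * u)) := by
  rw [coverageDensity, coverageDensity, mul_assoc _ (Real.exp _), ← Real.exp_add]
  ring_nf

variable {Ω : Type*} {α h θ lam ε : ℝ} {x : ℕ → Ω → EuclideanSpace ℝ (Fin 2)}

theorem pairwise_disjoint_hasIsolatedNearest (x : ℕ → Ω → EuclideanSpace ℝ (Fin 2)) (hε : 0 ≤ ε) :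
    Pairwise (Function.onFun Disjoint fun k : ℕ =>
      {ω | HasIsolatedNearest (k * ε) ((k + 1) * ε) (x · ω)}) := by
  refine (pairwise_disjoint_on _).2 fun k l hkl => disjoint_left.2 fun ω hk hl => ?_
  have hle : ((k : ℝ) + 1) * ε ≤ l * ε := by
    gcongr
    exact_mod_cast hkl
  exact not_hasIsolatedNearest_of_le hle (by positivity) hk hl

variable [MeasurableSpace Ω] {P : Measure Ω} {g : ℕ → Ω → ℝ}

theorem IsPoissonPointProcess.measure_compl_iUnion_hasIsolatedNearest_le
    (hx : IsPoissonPointProcess lam x P) (hlam : 0 < lam) (hε : 0 < ε) :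
    P (⋃ k : ℕ, {ω | HasIsolatedNearest (k * ε) ((k + 1) * ε) (x · ω)})ᶜ ≤
      ENNReal.ofReal (lam * Real.pi * ε) := by
  have := hx.isProbabilityMeasure
  have hmeas (k : ℕ) := measurableSet_hasIsolatedNearest hx.measurable (k * ε) ((k + 1) * ε)
  have hP (k : ℕ) : P {ω | HasIsolatedNearest (k * ε) ((k + 1) * ε) (x · ω)} =
      ENNReal.ofReal (ε * (lam * Real.pi * Real.exp (-(lam * Real.pi * ((k + 1) * ε))))) := by
    rw [hx.measure_hasIsolatedNearest hlam.le (by positivity) (by linarith)]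
    ring_nf
  have hsum := ofReal_mul_sub_le_tsum_exp (a := lam * Real.pi) (c := lam * Real.pi)
    (by positivity) (by positivity) hε
  simp_rw [← hP] at hsum
  rw [← measure_iUnion (pairwise_disjoint_hasIsolatedNearest x hε.le) hmeas] at hsum
  rw [prob_compl_eq_one_sub (.iUnion hmeas), tsub_le_iff_right]
  calc (1 : ℝ≥0∞)
    _ = ENNReal.ofReal (lam * Real.pi * ε + lam * Real.pi * (1 / (lam * Real.pi) - ε)) := by
        rw [← ENNReal.ofReal_one]
        congr 1
        field_simp
        ring
    _ ≤ _ := ENNReal.ofReal_add_le.trans (by gcongr)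

namespace IsRayleighNetwork

theorem measure_coverage_mem_Icc (hN : IsRayleighNetwork lam x g P) (hlam : 0 < lam)
    (hα : 2 < α) (hh : 0 < h) (hθ : 0 < θ) (hε : 0 < ε) {K : ℝ}
    (hK : K = ∫ u in Ioi 1, interferenceKernel (α / 2) θ u) :
    P {ω | ∃ i, (∀ j, ‖x i ω‖ ≤ ‖x j ω‖) ∧ ENNReal.ofReal θ < sir α h x g i ω} ∈
      Icc (ENNReal.ofReal (coverageDensity lam K (h ^ 2) 0 * (1 / (lam * Real.pi * (1 + K)) - ε)))
        (ENNReal.ofReal (coverageDensity lam K (h ^ 2) 0 * (1 / (lam * Real.pi * (1 + K)) + ε)) +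
          ENNReal.ofReal (lam * Real.pi * ε)) := by
  have := hN.poisson.isProbabilityMeasure
  have hK₀ : 0 < K := hK ▸ integral_interferenceKernel_pos (by linarith) hθ
  have hD : 0 ≤ coverageDensity lam K (h ^ 2) 0 := by unfold coverageDensity; positivity
  have hc : 0 < lam * Real.pi * (1 + K) := by positivity
  have hmeas (k : ℕ) :=
    measurableSet_hasIsolatedNearest hN.poisson.measurable (k * ε) ((k + 1) * ε)
  have hring (k : ℕ) := hN.setLIntegral_coverageEvent_mem_Icc hlam.le hα hh hθ
    (s := k * ε) (t := (k + 1) * ε) (by positivity) (by linarith) hK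
  have hwidth (k : ℕ) : ((k : ℝ) + 1) * ε - k * ε = ε := by ring
  simp_rw [hwidth, fun k : ℕ => coverageDensity_eq_mul_exp lam K (h ^ 2) (k * ε),
    fun k : ℕ => coverageDensity_eq_mul_exp lam K (h ^ 2) ((k + 1) * ε)] at hring
  have hunion := lintegral_iUnion hmeas (pairwise_disjoint_hasIsolatedNearest x hε.le) (μ := P)
    fun ω => P (coverageEvent α h θ (x · ω) g)
  rw [hN.measure_coverage_eq_lintegral]
  constructor
  · calc _ ≤ _ := ofReal_mul_sub_le_tsum_exp hD hc hε
      _ ≤ _ := ENNReal.tsum_le_tsum fun k => (hring k).1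
      _ = _ := hunion.symm
      _ ≤ _ := setLIntegral_le_lintegral _ _
  · rw [← lintegral_add_compl _ (.iUnion hmeas), hunion]
    gcongr ?_ + ?_
    · exact (ENNReal.tsum_le_tsum fun k => (hring k).2).trans (tsum_exp_le_ofReal_mul_add hD hc hε)
    · refine le_trans ?_ (hN.poisson.measure_compl_iUnion_hasIsolatedNearest_le hlam hε)
      exact (lintegral_mono fun ω => prob_le_one).trans_eq (setLIntegral_one _)

theorem coverageProbClosest_eq (hN : IsRayleighNetwork lam x g P) (hlam : 0 < lam) (hα : 2 < α)
    (hh : 0 < h) (hθ : 0 < θ) :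
    coverageProbClosest α h θ x g P =
      Real.exp (-(Real.pi * h ^ 2 * (eta α θ 1 1 - 1) * lam)) / eta α θ 1 1 := by
  have := hN.poisson.isProbabilityMeasure
  obtain ⟨K, hK⟩ : ∃ K, K = ∫ u in Ioi 1, interferenceKernel (α / 2) θ u := ⟨_, rfl⟩
  have hK₀ : 0 < K := hK ▸ integral_interferenceKernel_pos (by linarith) hθ
  have hD : 0 < coverageDensity lam K (h ^ 2) 0 := by unfold coverageDensity; positivity
  have hvalue : coverageDensity lam K (h ^ 2) 0 * (1 / (lam * Real.pi * (1 + K))) =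
      Real.exp (-(Real.pi * h ^ 2 * (1 + K - 1) * lam)) / (1 + K) := by
    rw [coverageDensity]
    field_simp
    ring_nf
  rw [eta_one_one hα hθ, ← hK, ← hvalue]
  refine eq_of_forall_dist_le fun δ hδ => ?_
  obtain ⟨ε, hε, hδε⟩ : ∃ ε > 0, δ = (coverageDensity lam K (h ^ 2) 0 + lam * Real.pi) * ε :=
    ⟨δ / (coverageDensity lam K (h ^ 2) 0 + lam * Real.pi), by positivity, by field_simp⟩
  obtain ⟨hlower, hupper⟩ := hN.measure_coverage_mem_Icc hlam hα hh hθ hε hK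
  rw [← ENNReal.ofReal_add (by positivity) (by positivity)] at hupper
  have hreal_lower := (ENNReal.ofReal_le_iff_le_toReal (measure_ne_top _ _)).1 hlower
  have hreal_upper := ENNReal.toReal_le_of_le_ofReal (by positivity) hupper
  rw [coverageProbClosest, measureReal_def, Real.dist_eq, abs_le]
  have : 0 < lam * Real.pi * ε := by positivity
  constructor <;> linarith

theorem aseClosest_eq (hN : IsRayleighNetwork lam x g P) (hlam : 0 < lam) (hα : 2 < α)
    (hh : 0 < h) (hθ : 0 < θ) :
    aseClosest α h θ lam x g P =
      lam * Real.exp (-(Real.pi * h ^ 2 * (eta α θ 1 1 - 1) * lam)) *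
        (Real.logb 2 (1 + θ) / eta α θ 1 1) := by
  rw [aseClosest, hN.coverageProbClosest_eq hlam hα hh hθ]
  ring

end IsRayleighNetwork

end RingDecomposition

end

theorem mainTheorem5 (α θ : ℝ) (hα : 2 < α) (hθ : 0 < θ) :
    ∃ C : ℝ, 0 < C ∧
      ∀ (Ω : ℝ → Type*) [∀ lam, MeasurableSpace (Ω lam)]
        (P : ∀ lam, MeasureTheory.Measure (Ω lam))
        [∀ lam, MeasureTheory.IsProbabilityMeasure (P lam)]
        (x : ∀ lam, ℕ → Ω lam → EuclideanSpace ℝ (Fin 2)) (g : ∀ lam, ℕ → Ω lam → ℝ),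
        (∀ lam, 0 < lam → IsRayleighNetwork lam (x lam) (g lam) (P lam)) →
        ∀ h : ℝ, 0 < h →
          {lam : ℝ | lam ∈ Set.Ioi 0 ∧
              IsMaxOn (fun l => aseClosest α h θ l (x l) (g l) (P l)) (Set.Ioi 0) lam} =
            {lamOpt α h θ} ∧
          aseClosest α h θ (lamOpt α h θ) (x (lamOpt α h θ)) (g (lamOpt α h θ))
              (P (lamOpt α h θ)) =
            Real.exp (-1) * Real.logb 2 (1 + θ) /
              (Real.pi * h ^ 2 * eta α θ 1 1 * (eta α θ 1 1 - 1)) ∧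
          aseClosest α h θ (lamOpt α h θ) (x (lamOpt α h θ)) (g (lamOpt α h θ))
              (P (lamOpt α h θ)) = C * (1 / h ^ 2) := by
  have hη := one_lt_eta_one_one hα hθ
  have hη_sub : 0 < eta α θ 1 1 - 1 := sub_pos.2 hη
  have hη_pos : 0 < eta α θ 1 1 := one_pos.trans hη
  have hlog : 0 < Real.logb 2 (1 + θ) := Real.logb_pos one_lt_two (by linarith)
  refine ⟨Real.exp (-1) * Real.logb 2 (1 + θ) / (Real.pi * eta α θ 1 1 * (eta α θ 1 1 - 1)),
    by positivity, fun Ω _ P _ x g hN h hh => ?_⟩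
  have ha : 0 < Real.pi * h ^ 2 * (eta α θ 1 1 - 1) := by positivity
  have hase (lam : ℝ) (hlam : 0 < lam) := (hN lam hlam).aseClosest_eq hlam hα hh hθ
  have hmax : aseClosest α h θ (lamOpt α h θ) (x (lamOpt α h θ)) (g (lamOpt α h θ))
      (P (lamOpt α h θ)) = Real.exp (-1) * Real.logb 2 (1 + θ) /
        (Real.pi * h ^ 2 * eta α θ 1 1 * (eta α θ 1 1 - 1)) := by
    rw [hase (lamOpt α h θ) (one_div_pos.2 ha), lamOpt, mul_one_div_cancel ha.ne']
    field_simp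
  exact ⟨setOf_isMaxOn_mul_exp_neg ha (div_pos hlog hη_pos) hase, hmax,
    hmax.trans (by field_simp)⟩
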